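/- Let $N\ge 0$, let $R\subset\mathbb R^N$ be a root system normalized by $\langle u,u\rangle=2$ for all $u\in R$ (that is, $R$ is finite and $R\cap\mathbb Ru=\{\pm u\}$, $\sigma_uR=R$ for all $u\in R$, where $\sigma_u$ is the reflection in the hyperplane orthogonal to $u$), let $R_+=\{u\in R:\langle u,v\rangle>0\}$ be the positive subsystem given by a vector $v$ with $\langle u,v\rangle\neq0$ for all $u\in R$, and let $k:R\to[0,\infty)$ be a multiplicity function, i.e. $k(gu)=k(u)$ for all $u\in R$ and all $g$ in the group generated by the reflections $\sigma_u$, $u\in R$. Put $\omega_k(x)=\prod_{\eta\in R_+}|\langle\eta,x\rangle|^{2k(\eta)}$, $c_k=\left(\int_{\mathbb R^N}e^{-|x|^2}\omega_k(x)\,dx\right)^{-1}$ and $H=L^2(\mathbb R^N,\omega_k(x)\,dx)$ (complex-valued functions). Let $$T_ip(x)=\partial_ip(x)+\sum_{\eta\in R_+}k(\eta)\,\eta_i\,\frac{p(x)-p(\sigma_\eta x)}{\langle\eta,x\rangle},\qquad \Delta_k=\sum_{i=1}^NT_i^2,$$ be the Dunkl operators and the Dunkl Laplacian on polynomials. Let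 $\{\varphi_\nu\}_{\nu\in\mathbb Z_+^N}$ be any basis of the space of polynomials such that $\varphi_\nu$ has real coefficients, is homogeneous of degree $|\nu|$, and $\{\varphi_\nu\}$ is orthonormal for the pairing $[p,q]_k=(p(T_1,\dots,T_N)q)(0)$. Let $$h_\nu(x)=\sqrt{c_k}\,2^{-|\nu|/2}e^{-|x|^2/2}H_\nu(x),\qquad H_\nu=2^{|\nu|}e^{-\Delta_k/4}\varphi_\nu,$$ be the associated generalized Hermite functions, and for $\alpha\in\mathbb R$, $f\in H$ let $$D_k^\alpha f=\sum_{\nu\in\mathbb Z_+^N}e^{i|\nu|\alpha}\langle f,h_\nu\rangle h_\nu,\qquad \langle f,h_\nu\rangle=\int_{\mathbb R^N}f\,\overline{h_\nu}\,\omega_k\,dx,$$ be the fractional Dunkl transform. Let $T$ be the infinitesimal generator of $\{D_k^\alpha\}_{\alpha\in\mathbb R}$: $D(T)$ is the set of $f\in H$ for which $\lim_{\alpha\to0}\alpha^{-1}(D_k^\alpha f-f)$ exists in $H$, and $Tf$ is this limit. Then $T$ is a linear operator, and: 1) $T$ is closed and densely defined. 2) $iT$ is self-adjoint. 3) Let $\rho(T)$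 be the set of all $\lambda\in\mathbb C$ for which $\lambda I-T:D(T)\to H$ is bijective with bounded inverse $R(\lambda,T)$, $\sigma(T)=\mathbb C\setminus\rho(T)$, and $\sigma_p(T)=\{\lambda\in\mathbb C:\lambda I-T\text{ is not injective}\}$. Then $\sigma(T)=\sigma_p(T)\subset i\mathbb Z$, and for every $\lambda\in\mathbb C\setminus i\mathbb Z$ and every $f\in H$ the function $s\mapsto e^{-\lambda s}D_k^sf$ is integrable on $[0,2\pi]$ and $$R(\lambda,T)f=(1-e^{-2\pi\lambda})^{-1}\int_0^{2\pi}e^{-\lambda s}D_k^sf\,ds.$$ -/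

import Mathlib

open MeasureTheory Filter Topology
open scoped NNReal

noncomputable section

namespace Dunkl

/-- Euclidean space `ℝ^N`. -/
abbrev Space (N : ℕ) := EuclideanSpace ℝ (Fin N)

variable {N : ℕ}

/-! ### Root systems and multiplicity functions -/

/-- The reflection in the hyperplane orthogonal to `u`. -/
abbrev refl (u : Space N) : Space N ≃ₗᵢ[ℝ] Space N := (ℝ ∙ u)ᗮ.reflection

/-- A (reduced) root system in `ℝ^N`, normalized by `⟨u, u⟩ = 2`; in particular the roots are
nonzero. -/
structure IsRootSystem (R : Finset (Space N)) : Prop where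
  inner_self : ∀ u ∈ R, inner ℝ u u = 2
  inter_line : ∀ u ∈ R, (R : Set (Space N)) ∩ {x | ∃ t : ℝ, x = t • u} = {u, -u}
  refl_image : ∀ u ∈ R, refl u '' (R : Set (Space N)) = R

/-- `P` is the positive subsystem of `R` determined by some vector `v` that lies on none of the
hyperplanes orthogonal to the roots. -/
def IsPositiveSubsystem (R P : Finset (Space N)) : Prop :=
  ∃ v : Space N, (∀ u ∈ R, inner ℝ u v ≠ 0) ∧ ∀ u, u ∈ P ↔ u ∈ R ∧ 0 < inner ℝ u v

/-- The reflection group generated by the reflections in the roots. -/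
def weylGroup (R : Finset (Space N)) : Subgroup (Space N ≃ₗᵢ[ℝ] Space N) :=
  Subgroup.closure {g | ∃ u ∈ R, g = refl u}

/-- `k` is a (nonnegative) multiplicity function on `R`: it is constant on the orbits of the
reflection group. The values of `k` outside `R` are irrelevant. -/
def IsMultiplicity (R : Finset (Space N)) (k : Space N → ℝ≥0) : Prop :=
  ∀ g ∈ weylGroup R, ∀ u ∈ R, k (g u) = k u

/-! ### The weighted space `L²(ℝ^N, ω_k(x) dx)` -/

/-- The weight `ω_k(x) = ∏_{η ∈ R₊} |⟨η, x⟩|^{2 k(η)}`. -/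
def weight (P : Finset (Space N)) (k : Space N → ℝ≥0) (x : Space N) : ℝ :=
  ∏ η ∈ P, |inner ℝ η x| ^ (2 * (k η : ℝ))

/-- The measure `ω_k(x) dx`. -/
def weightMeasure (P : Finset (Space N)) (k : Space N → ℝ≥0) : Measure (Space N) :=
  volume.withDensity fun x => ENNReal.ofReal (weight P k x)

/-- The Hilbert space `L²(ℝ^N, ω_k(x) dx)` of complex-valued functions. -/
abbrev L2 (P : Finset (Space N)) (k : Space N → ℝ≥0) := Lp ℂ 2 (weightMeasure P k)

/-- The Mehta-type constant `c_k = (∫ e^{-|x|²} ω_k(x) dx)⁻¹`. -/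
def mehta (P : Finset (Space N)) (k : Space N → ℝ≥0) : ℝ :=
  (∫ x, Real.exp (-‖x‖ ^ 2) * weight P k x)⁻¹

/-! ### Dunkl operators on polynomials -/

/-- The linear form `x ↦ ⟨η, x⟩` as a polynomial. -/
def linForm (η : Space N) : MvPolynomial (Fin N) ℝ :=
  ∑ i, MvPolynomial.C (η i) * MvPolynomial.X i

/-- The action `p ↦ p ∘ σ_η` of the reflection
`σ_η(x) = x - (2 ⟨η, x⟩ / |η|²) η` on polynomials. -/
def reflPoly (η : Space N) : MvPolynomial (Fin N) ℝ →ₐ[ℝ] MvPolynomial (Fin N) ℝ :=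
  MvPolynomial.aeval fun i =>
    MvPolynomial.X i - MvPolynomial.C (2 / ‖η‖ ^ 2 * η i) * linForm η

theorem linForm_dvd (η : Space N) (p : MvPolynomial (Fin N) ℝ) :
    ∃ q, linForm η * q = p - reflPoly η p := by
  induction p using MvPolynomial.induction_on with
  | C a => exact ⟨0, by simp [reflPoly]⟩
  | add p q hp hq =>
    obtain ⟨a, ha⟩ := hp
    obtain ⟨b, hb⟩ := hq
    exact ⟨a + b, by rw [mul_add, ha, hb, map_add]; ring⟩
  | mul_X p i hp =>
    obtain ⟨a, ha⟩ := hp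
    refine ⟨a * MvPolynomial.X i + reflPoly η p * MvPolynomial.C (2 / ‖η‖ ^ 2 * η i), ?_⟩
    have hX : reflPoly η (MvPolynomial.X i) =
        MvPolynomial.X i - MvPolynomial.C (2 / ‖η‖ ^ 2 * η i) * linForm η := by
      simp [reflPoly]
    rw [map_mul (reflPoly η) p, hX]
    linear_combination MvPolynomial.X i * ha

/-- The divided difference `(p(x) - p(σ_η x)) / ⟨η, x⟩`, which is again a polynomial; it is
chosen on monomials and extended linearly. See `linForm_mul_divDiff`. -/
def divDiff (η : Space N) : MvPolynomial (Fin N) ℝ →ₗ[ℝ] MvPolynomial (Fin N) ℝ :=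
  (MvPolynomial.basisMonomials (Fin N) ℝ).constr ℝ fun ν =>
    (linForm_dvd η (MvPolynomial.monomial ν 1)).choose

theorem linForm_mul_divDiff (η : Space N) (p : MvPolynomial (Fin N) ℝ) :
    linForm η * divDiff η p = p - reflPoly η p := by
  have h : (LinearMap.mulLeft ℝ (linForm η)) ∘ₗ divDiff η =
      LinearMap.id - (reflPoly η).toLinearMap := by
    refine (MvPolynomial.basisMonomials (Fin N) ℝ).ext fun ν => ?_
    have := (linForm_dvd η (MvPolynomial.monomial ν 1)).choose_spec
    rw [LinearMap.comp_apply, divDiff, Module.Basis.constr_basis]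
    simpa using this
  simpa using LinearMap.congr_fun h p

/-- The Dunkl operator `T_i = T_{e_i}` on polynomials:
`T_i p = ∂_i p + ∑_{η ∈ R₊} k(η) ⟨η, e_i⟩ (p - p ∘ σ_η) / ⟨η, ·⟩`. -/
def dunklOp (P : Finset (Space N)) (k : Space N → ℝ≥0) (i : Fin N) :
    MvPolynomial (Fin N) ℝ →ₗ[ℝ] MvPolynomial (Fin N) ℝ :=
  (MvPolynomial.pderiv i).toLinearMap + ∑ η ∈ P, ((k η : ℝ) * η i) • divDiff η

/-- The Dunkl Laplacian `Δ_k = ∑_i T_i²` on polynomials. -/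
def dunklLaplacian (P : Finset (Space N)) (k : Space N → ℝ≥0) :
    MvPolynomial (Fin N) ℝ →ₗ[ℝ] MvPolynomial (Fin N) ℝ :=
  ∑ i, dunklOp P k i ∘ₗ dunklOp P k i

/-- `e^{-Δ_k/4} p`. The Dunkl Laplacian lowers the degree of a polynomial by two (it annihilates
polynomials of degree at most one), so that the exponential series is the finite sum below. -/
def expLaplacian (P : Finset (Space N)) (k : Space N → ℝ≥0) (p : MvPolynomial (Fin N) ℝ) :
    MvPolynomial (Fin N) ℝ :=
  ∑ n ∈ Finset.range (p.totalDegree + 1),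
    ((-1 / 4 : ℝ) ^ n / (n.factorial : ℝ)) • (dunklLaplacian P k ^ n) p

/-- The differential-difference operator `p(T) = p(T_1, …, T_N)`. (The Dunkl operators commute, so
that the order of the factors in a monomial is immaterial.) -/
def polyDunkl (P : Finset (Space N)) (k : Space N → ℝ≥0) (p : MvPolynomial (Fin N) ℝ) :
    MvPolynomial (Fin N) ℝ →ₗ[ℝ] MvPolynomial (Fin N) ℝ :=
  ∑ ν ∈ p.support, p.coeff ν • (List.ofFn fun i => dunklOp P k i ^ ν i).prod

/-- The pairing `[p, q]_k = (p(T) q)(0)` of polynomials with real coefficients. -/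
def pairing (P : Finset (Space N)) (k : Space N → ℝ≥0) (p q : MvPolynomial (Fin N) ℝ) : ℝ :=
  MvPolynomial.eval 0 (polyDunkl P k p q)

/-- `{φ_ν}` is an orthonormal basis of the space of polynomials with respect to `[·,·]_k`, with
real coefficients and with `φ_ν` homogeneous of degree `|ν|`. -/
structure IsOrthonormalPolynomialBasis (P : Finset (Space N)) (k : Space N → ℝ≥0)
    (φ : (Fin N →₀ ℕ) → MvPolynomial (Fin N) ℝ) : Prop where
  homogeneous : ∀ ν, (φ ν).IsHomogeneous ν.degree
  orthonormal : ∀ ν μ, pairing P k (φ ν) (φ μ) = if ν = μ then 1 else 0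
  span_eq_top : Submodule.span ℝ (Set.range φ) = ⊤

/-! ### Generalized Hermite functions -/

/-- The generalized Hermite polynomial `H_ν = 2^{|ν|} e^{-Δ_k/4} φ_ν`. -/
def hermitePoly (P : Finset (Space N)) (k : Space N → ℝ≥0)
    (φ : (Fin N →₀ ℕ) → MvPolynomial (Fin N) ℝ) (ν : Fin N →₀ ℕ) : MvPolynomial (Fin N) ℝ :=
  (2 : ℝ) ^ ν.degree • expLaplacian P k (φ ν)

/-- The generalized Hermite function
`h_ν(x) = √c_k 2^{-|ν|/2} e^{-|x|²/2} H_ν(x)`. -/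
def hermiteFun (P : Finset (Space N)) (k : Space N → ℝ≥0)
    (φ : (Fin N →₀ ℕ) → MvPolynomial (Fin N) ℝ) (ν : Fin N →₀ ℕ) (x : Space N) : ℝ :=
  √(mehta P k) / (2 : ℝ) ^ ((ν.degree : ℝ) / 2) * Real.exp (-‖x‖ ^ 2 / 2) *
    MvPolynomial.eval (fun i => x i) (hermitePoly P k φ ν)

theorem eval_bound (p : MvPolynomial (Fin N) ℝ) : ∃ C : ℝ, ∃ n : ℕ, 0 ≤ C ∧
    ∀ x : Space N, |MvPolynomial.eval (fun i => x i) p| ≤ C * (1 + ‖x‖) ^ n := by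
  induction p using MvPolynomial.induction_on with
  | C a => exact ⟨|a|, 0, abs_nonneg a, fun x => by simp⟩
  | add p q hp hq =>
    obtain ⟨C, n, hC, h⟩ := hp
    obtain ⟨D, m, hD, h'⟩ := hq
    refine ⟨C + D, n + m, by positivity, fun x => ?_⟩
    have h1 : (1 : ℝ) ≤ 1 + ‖x‖ := by linarith [norm_nonneg x]
    have e1 : (1 + ‖x‖) ^ n ≤ (1 + ‖x‖) ^ (n + m) := pow_le_pow_right₀ h1 (by omega)
    have e2 : (1 + ‖x‖) ^ m ≤ (1 + ‖x‖) ^ (n + m) := pow_le_pow_right₀ h1 (by omega)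
    rw [map_add, add_mul]
    exact (abs_add_le _ _).trans (add_le_add
      ((h x).trans (mul_le_mul_of_nonneg_left e1 hC))
      ((h' x).trans (mul_le_mul_of_nonneg_left e2 hD)))
  | mul_X p i hp =>
    obtain ⟨C, n, hC, h⟩ := hp
    refine ⟨C, n + 1, hC, fun x => ?_⟩
    have hx : |x i| ≤ 1 + ‖x‖ := by
      have := PiLp.norm_apply_le x i
      rw [Real.norm_eq_abs] at this
      linarith
    rw [map_mul, MvPolynomial.eval_X, abs_mul, pow_succ, ← mul_assoc]
    exact mul_le_mul (h x) hx (abs_nonneg _) (by positivity)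

theorem weight_nonneg (P : Finset (Space N)) (k : Space N → ℝ≥0) (x : Space N) :
    0 ≤ weight P k x :=
  Finset.prod_nonneg fun _ _ => by positivity

theorem weight_bound (P : Finset (Space N)) (k : Space N → ℝ≥0) : ∃ C : ℝ, ∃ n : ℕ, 0 ≤ C ∧
    ∀ x : Space N, weight P k x ≤ C * (1 + ‖x‖) ^ n := by
  classical
  induction P using Finset.induction_on with
  | empty => exact ⟨1, 0, zero_le_one, fun x => by simp [weight]⟩
  | insert η P hη ih =>
    obtain ⟨C, n, hC, h⟩ := ih
    refine ⟨‖η‖ ^ (2 * (k η : ℝ)) * C, ⌈2 * (k η : ℝ)⌉₊ + n, by positivity, fun x => ?_⟩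
    have h1 : (1 : ℝ) ≤ 1 + ‖x‖ := by linarith [norm_nonneg x]
    have hw : weight (insert η P) k x = |inner ℝ η x| ^ (2 * (k η : ℝ)) * weight P k x := by
      simp [weight, Finset.prod_insert hη]
    have h2 : |inner ℝ η x| ^ (2 * (k η : ℝ)) ≤
        ‖η‖ ^ (2 * (k η : ℝ)) * (1 + ‖x‖) ^ ⌈2 * (k η : ℝ)⌉₊ := by
      calc |inner ℝ η x| ^ (2 * (k η : ℝ)) ≤ (‖η‖ * (1 + ‖x‖)) ^ (2 * (k η : ℝ)) := by
            refine Real.rpow_le_rpow (abs_nonneg _) ?_ (by positivity)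
            exact (abs_real_inner_le_norm η x).trans
              (mul_le_mul_of_nonneg_left (by linarith) (norm_nonneg η))
        _ = ‖η‖ ^ (2 * (k η : ℝ)) * (1 + ‖x‖) ^ (2 * (k η : ℝ)) :=
            Real.mul_rpow (norm_nonneg _) (by positivity)
        _ ≤ _ := by
            refine mul_le_mul_of_nonneg_left ?_ (by positivity)
            rw [← Real.rpow_natCast]
            exact Real.rpow_le_rpow_of_exponent_le h1 (Nat.le_ceil _)
    rw [hw]
    calc _ ≤ (‖η‖ ^ (2 * (k η : ℝ)) * (1 + ‖x‖) ^ ⌈2 * (k η : ℝ)⌉₊) * (C * (1 + ‖x‖) ^ n) :=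
          mul_le_mul h2 (h x) (weight_nonneg P k x) (by positivity)
      _ = _ := by rw [pow_add]; ring

theorem measurable_weight (P : Finset (Space N)) (k : Space N → ℝ≥0) :
    Measurable (weight P k) := by
  unfold weight
  fun_prop

theorem pow_mul_exp_le (r : ℝ) (hr : 0 ≤ r) (n : ℕ) :
    (1 + r) ^ n * Real.exp (-r ^ 2) ≤ n.factorial * Real.exp 2 := by
  have h1 : (1 + r) ^ n ≤ n.factorial * Real.exp (1 + r) := by
    have := Real.pow_div_factorial_le_exp (1 + r) (by linarith) n
    rwa [div_le_iff₀ (by positivity), mul_comm] at this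
  calc (1 + r) ^ n * Real.exp (-r ^ 2)
      ≤ n.factorial * Real.exp (1 + r) * Real.exp (-r ^ 2) := by gcongr
    _ = n.factorial * Real.exp (1 + r + -r ^ 2) := by rw [Real.exp_add (1 + r)]; ring
    _ ≤ n.factorial * Real.exp 2 := by
        gcongr
        nlinarith [sq_nonneg (r - 1)]

/-- The generalized Hermite functions are square integrable with respect to `ω_k(x) dx`. -/
theorem memLp_hermiteFun (P : Finset (Space N)) (k : Space N → ℝ≥0)
    (φ : (Fin N →₀ ℕ) → MvPolynomial (Fin N) ℝ) (ν : Fin N →₀ ℕ) :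
    MemLp (fun x => (hermiteFun P k φ ν x : ℂ)) 2 (weightMeasure P k) := by
  have hc : Continuous (hermiteFun P k φ ν) := by
    unfold hermiteFun
    have : Continuous fun x : Space N =>
        MvPolynomial.eval (fun i => x i) (hermitePoly P k φ ν) :=
      (MvPolynomial.continuous_eval (hermitePoly P k φ ν)).comp (by fun_prop)
    fun_prop
  have hm := measurable_weight P k
  have hc' : Continuous fun x => (hermiteFun P k φ ν x : ℂ) := Complex.continuous_ofReal.comp hc
  refine (memLp_two_iff_integrable_sq_norm hc'.aestronglyMeasurable).2 ?_
  rw [weightMeasure, integrable_withDensity_iff (hm.ennreal_ofReal) (by simp)]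
  obtain ⟨C, n, hC, hp⟩ := eval_bound (hermitePoly P k φ ν)
  obtain ⟨D, m, hD, hw⟩ := weight_bound P k
  set A : ℝ := √(mehta P k) / (2 : ℝ) ^ ((ν.degree : ℝ) / 2) with hA
  have hint := (integrable_one_add_norm (E := Space N) (μ := volume)
    (r := ((N + 1 : ℕ) : ℝ)) (by simp)).const_mul
      (A ^ 2 * C ^ 2 * D * ((n + n + m + (N + 1)).factorial * Real.exp 2))
  refine hint.mono' ((hc'.measurable.norm.pow_const 2).mul
    hm.ennreal_ofReal.ennreal_toReal).aestronglyMeasurable (Eventually.of_forall fun x => ?_)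
  have hr : 0 ≤ ‖x‖ := norm_nonneg x
  set r := ‖x‖ with hrdef
  have hwx := hw x
  have hw0 := weight_nonneg P k x
  have hpx := hp x
  have hsq : MvPolynomial.eval (fun i => x i) (hermitePoly P k φ ν) ^ 2
      ≤ (C * (1 + r) ^ n) ^ 2 := by
    rw [← sq_abs]; gcongr
  have hE : (Real.exp (-r ^ 2 / 2)) ^ 2 = Real.exp (-r ^ 2) := by
    rw [← Real.exp_nat_mul]; congr 1; push_cast; ring
  have hkey := pow_mul_exp_le r hr (n + n + m + (N + 1))
  rw [ENNReal.toReal_ofReal (weight_nonneg P k x), Real.norm_of_nonneg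
    (mul_nonneg (by positivity) (weight_nonneg P k x)), Complex.norm_real, Real.norm_eq_abs,
    sq_abs, Real.rpow_neg (by positivity), Real.rpow_natCast]
  have hpos : 0 < (1 + r) ^ (N + 1) := by positivity
  rw [← div_eq_mul_inv, le_div_iff₀ hpos]
  unfold hermiteFun
  rw [← hA, ← hrdef, mul_pow, mul_pow, hE]
  calc A ^ 2 * Real.exp (-r ^ 2) *
        MvPolynomial.eval (fun i => x i) (hermitePoly P k φ ν) ^ 2 * weight P k x *
        (1 + r) ^ (N + 1)
      ≤ A ^ 2 * Real.exp (-r ^ 2) * (C * (1 + r) ^ n) ^ 2 * (D * (1 + r) ^ m) *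
        (1 + r) ^ (N + 1) := by
        gcongr
    _ = A ^ 2 * C ^ 2 * D * ((1 + r) ^ (n + n + m + (N + 1)) * Real.exp (-r ^ 2)) := by
        rw [pow_add, pow_add, pow_add]; ring
    _ ≤ _ := by gcongr

/-- The generalized Hermite function `h_ν` as an element of `L²(ℝ^N, ω_k(x) dx)`. -/
def hermiteL2 (P : Finset (Space N)) (k : Space N → ℝ≥0)
    (φ : (Fin N →₀ ℕ) → MvPolynomial (Fin N) ℝ) (ν : Fin N →₀ ℕ) : L2 P k :=
  (memLp_hermiteFun P k φ ν).toLp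

/-! ### The fractional Dunkl transform -/

/-- The fractional Dunkl transform `D_k^α f = ∑_ν e^{i|ν|α} ⟨f, h_ν⟩ h_ν`, where
`⟨f, h_ν⟩ = ∫ f \overline{h_ν} ω_k dx` (Mathlib's inner product is linear in the second
argument). -/
def fracDunkl (P : Finset (Space N)) (k : Space N → ℝ≥0)
    (φ : (Fin N →₀ ℕ) → MvPolynomial (Fin N) ℝ) (α : ℝ) (f : L2 P k) : L2 P k :=
  ∑' ν : Fin N →₀ ℕ, (Complex.exp (Complex.I * (ν.degree : ℂ) * (α : ℂ)) *
    inner ℂ (hermiteL2 P k φ ν) f) • hermiteL2 P k φ ν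

end Dunkl

/-! ### Generators and spectra of unbounded operators -/

namespace Unbounded

variable {H : Type*} [NormedAddCommGroup H] [NormedSpace ℂ H]

/-- `T` is the infinitesimal generator of the family `U`: its domain consists of all `f` for which
`(1/α) (U α f - f)` converges as `α → 0`, and `T f` is the limit. -/
def IsGenerator (U : ℝ → H → H) (T : H →ₗ.[ℂ] H) : Prop :=
  ∀ f g : H, (f, g) ∈ T.graph ↔ Tendsto (fun α : ℝ => (α : ℂ)⁻¹ • (U α f - f)) (𝓝[≠] 0) (𝓝 g)

/-- The operator `λ I - T` on the domain of `T`. -/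
def shift (T : H →ₗ.[ℂ] H) (z : ℂ) (x : T.domain) : H := z • (x : H) - T x

/-- `R` is a bounded inverse of `λ I - T : D(T) → H`. -/
def IsResolvent (T : H →ₗ.[ℂ] H) (z : ℂ) (R : H →L[ℂ] H) : Prop :=
  Function.Bijective (shift T z) ∧ ∀ x : T.domain, R (shift T z x) = x

/-- The resolvent set `ρ(T)`. -/
def resolventSet (T : H →ₗ.[ℂ] H) : Set ℂ := {z | ∃ R : H →L[ℂ] H, IsResolvent T z R}

/-- The spectrum `σ(T)`. -/
def spectrum (T : H →ₗ.[ℂ] H) : Set ℂ := (resolventSet T)ᶜ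

/-- The point spectrum `σ_p(T)`. -/
def pointSpectrum (T : H →ₗ.[ℂ] H) : Set ℂ := {z | ¬ Function.Injective (shift T z)}

open Classical in
/-- The resolvent `R(λ, T) = (λ I - T)⁻¹` (and `0` if `λ` is not in the resolvent set). -/
def resolvent (T : H →ₗ.[ℂ] H) (z : ℂ) : H →L[ℂ] H :=
  if h : ∃ R : H →L[ℂ] H, IsResolvent T z R then h.choose else 0

end Unbounded

end

/-!
The generalized Hermite functions `h_ν` form a Hilbert basis of `L²(ω_k dx)`. Hence the fractional
Dunkl transforms are the unitary group which is diagonal in this basis with the frequencies `|ν|`,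
and its generator is the maximal diagonal operator `h_ν ↦ i |ν| h_ν`. All assertions about the
generator can then be read off from coefficients: its graph is cut out by the equations
`g_ν = i |ν| f_ν` (`Unbounded.mem_graph_diagOp`), its spectrum is the closed set `{i |ν|}` of its
eigenvalues (`Unbounded.spectrum_diagOp`), and the coefficients of the Laplace transform of the
group over one period are elementary integrals (`Unbounded.resolvent_diagOp`).

*Orthonormality.* The algebraic input is the commutator of `T_i` with the multiplication by `x_j`
(`dunklOp_X_mul`) and the equivariance of the `T_i` under reflections (`reflPoly_dunklOp`). They
yield `[Δ_k, x_j] = 2 T_j` and, through the Jacobi identity, the commutativity of the Dunkl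
operators (`dunklOp_comm`); consequently `e^{-Δ_k/4}` conjugates `x_j` into `x_j - T_j / 2`. The
analytic input is that `T_i` has the adjoint `2 x_i - T_i` with respect to `e^{-|x|²} ω_k dx`
(`gaussInt_dunklOp_mul`). It is obtained by integration by parts for the smooth weights
`∏ (⟨η, x⟩² + ε)^{k(η)}`: their logarithmic derivatives are odd under reflections, so that they
turn into divided differences, which stay bounded as `ε → 0`. Both together show that in the
bilinear form `c_k ∫ (e^{-Δ_k/4} p) (e^{-Δ_k/4} q) e^{-|x|²} ω_k dx` the multiplication by `x_i`
has the adjoint `T_i / 2`, and this determines the form as a multiple of `[p, q]_k` on homogeneous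
`p` (`gaussInt_expLaplacian_mul`).

*Completeness.* As `e^{-Δ_k/4}` is surjective on polynomials, a function `f` orthogonal to all
`h_ν` is orthogonal to all products of a polynomial and the Gaussian `e^{-|x|²/2}`. So the Fourier
transform of the integrable function `f e^{-|x|²/2} ω_k` vanishes (`eq_zero_of_moments_eq_zero`).
-/


namespace Unbounded

/-! ### Diagonal operators in a Hilbert basis -/

variable {H : Type*} [NormedAddCommGroup H] [InnerProductSpace ℂ H] {ι : Type*}

theorem repr_injective (b : HilbertBasis ι ℂ H) {f g : H}
    (h : ∀ j, b.repr f j = b.repr g j) : f = g :=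
  b.repr.injective (by ext j; exact h j)

theorem continuous_repr (b : HilbertBasis ι ℂ H) (j : ι) : Continuous fun f => b.repr f j := by
  simp only [b.repr_apply_apply]
  fun_prop

theorem repr_basis [DecidableEq ι] (b : HilbertBasis ι ℂ H) (j l : ι) :
    b.repr (b j) l = if l = j then 1 else 0 := by
  rw [b.repr_self, lp.single_apply]
  by_cases hl : l = j
  · subst hl
    simp
  · simp [hl]

theorem repr_add_apply (b : HilbertBasis ι ℂ H) (f g : H) (j : ι) :
    b.repr (f + g) j = b.repr f j + b.repr g j := by
  simp

theorem repr_sub_apply (b : HilbertBasis ι ℂ H) (f g : H) (j : ι) :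
    b.repr (f - g) j = b.repr f j - b.repr g j := by
  simp

theorem repr_smul_apply (b : HilbertBasis ι ℂ H) (c : ℂ) (f : H) (j : ι) :
    b.repr (c • f) j = c * b.repr f j := by
  simp

theorem hasSum_norm_repr_sq (b : HilbertBasis ι ℂ H) (f : H) :
    HasSum (fun j => ‖b.repr f j‖ ^ 2) (‖f‖ ^ 2) := by
  have := lp.hasSum_norm (p := 2) (by simp) (b.repr f)
  simpa using this

theorem exists_repr_eq (b : HilbertBasis ι ℂ H) {g : ι → ℂ} (hg : Summable fun j => ‖g j‖ ^ 2) :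
    ∃ f, ∀ j, b.repr f j = g j := by
  have hm : Memℓp g 2 := memℓp_gen (by simpa using hg)
  refine ⟨b.repr.symm ⟨g, hm⟩, fun j => ?_⟩
  rw [LinearIsometryEquiv.apply_symm_apply]

/-- Dominated convergence for the coefficients in a Hilbert basis. -/
theorem tendsto_of_tendsto_repr (b : HilbertBasis ι ℂ H) {α : Type*} {l : Filter α}
    {F : α → H} {g : H} {c : ι → ℝ} (hc : Summable fun j => c j ^ 2)
    (hb : ∀ᶠ a in l, ∀ j, ‖b.repr (F a) j - b.repr g j‖ ≤ c j)
    (hF : ∀ j, Tendsto (fun a => b.repr (F a) j) l (𝓝 (b.repr g j))) : Tendsto F l (𝓝 g) := by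
  rw [tendsto_iff_norm_sub_tendsto_zero]
  have h1 : Tendsto (fun a => ∑' j, ‖b.repr (F a - g) j‖ ^ 2) l (𝓝 (∑' _ : ι, (0 : ℝ))) := by
    refine tendsto_tsum_of_dominated_convergence hc (fun j => ?_) ?_
    · have := ((tendsto_iff_norm_sub_tendsto_zero.1 (hF j)).pow 2)
      simpa [repr_sub_apply] using this
    · filter_upwards [hb] with a ha j
      rw [repr_sub_apply, Real.norm_of_nonneg (by positivity)]
      exact pow_le_pow_left₀ (norm_nonneg _) (ha j) 2
  simp only [(hasSum_norm_repr_sq b _).tsum_eq, tsum_zero] at h1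
  have h2 := h1.sqrt
  simpa using h2

/-- The bounded diagonal operator with eigenvalues `m j`. -/
theorem exists_bounded_diag (b : HilbertBasis ι ℂ H) {m : ι → ℂ} {C : ℝ} (hm : ∀ j, ‖m j‖ ≤ C) :
    ∃ A : H →L[ℂ] H, ∀ f j, b.repr (A f) j = m j * b.repr f j := by
  have hle : ∀ (f : H) j, ‖m j * b.repr f j‖ ^ 2 ≤ C ^ 2 * ‖b.repr f j‖ ^ 2 := fun f j => by
    rw [norm_mul, mul_pow]
    have := pow_le_pow_left₀ (norm_nonneg _) (hm j) 2
    gcongr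
  have hs : ∀ f : H, Summable fun j => C ^ 2 * ‖b.repr f j‖ ^ 2 := fun f =>
    (hasSum_norm_repr_sq b f).summable.mul_left _
  have hex : ∀ f : H, ∃ g, ∀ j, b.repr g j = m j * b.repr f j := fun f =>
    exists_repr_eq b (Summable.of_nonneg_of_le (fun j => by positivity) (hle f) (hs f))
  choose A hA using hex
  let L : H →ₗ[ℂ] H :=
    { toFun := A
      map_add' := fun f g => repr_injective b fun j => by
        simp only [repr_add_apply, hA, mul_add]
      map_smul' := fun c f => repr_injective b fun j => by
        simp only [repr_smul_apply, hA, RingHom.id_apply]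
        ring }
  refine ⟨L.mkContinuous |C| fun f => ?_, hA⟩
  refine (sq_le_sq₀ (norm_nonneg _) (by positivity)).1 ?_
  rw [mul_pow, sq_abs, ← (hasSum_norm_repr_sq b _).tsum_eq, ← (hasSum_norm_repr_sq b f).tsum_eq,
    ← tsum_mul_left]
  refine (hasSum_norm_repr_sq b _).summable.tsum_le_tsum (fun j => ?_) (hs f)
  change ‖b.repr (A f) j‖ ^ 2 ≤ _
  rw [hA]
  exact hle f j

/-- The graph of the maximal diagonal operator with `b j ↦ a j • b j`: the pairs of vectors whose
coefficients are related by the eigenvalues `a j`. -/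
def diagGraph (b : HilbertBasis ι ℂ H) (a : ι → ℂ) : Submodule ℂ (H × H) where
  carrier := {p | ∀ j, b.repr p.2 j = a j * b.repr p.1 j}
  add_mem' := fun hp hq j => by
    simp only [Prod.fst_add, Prod.snd_add, repr_add_apply]
    rw [hp j, hq j, mul_add]
  zero_mem' := fun j => by simp
  smul_mem' := fun c p hp j => by
    simp only [Prod.smul_fst, Prod.smul_snd, repr_smul_apply]
    rw [hp j, mul_left_comm]

/-- The maximal diagonal operator with `b j ↦ a j • b j`. -/
noncomputable def diagOp (b : HilbertBasis ι ℂ H) (a : ι → ℂ) : H →ₗ.[ℂ] H :=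
  (diagGraph b a).toLinearPMap

variable (b : HilbertBasis ι ℂ H) (a : ι → ℂ)

theorem mem_graph_diagOp {f g : H} : (f, g) ∈ (diagOp b a).graph ↔
    ∀ j, b.repr g j = a j * b.repr f j := by
  rw [diagOp, Submodule.toLinearPMap_graph_eq]
  · rfl
  · rintro ⟨f, g⟩ hp (rfl : f = 0)
    exact repr_injective b fun j => by simpa using hp j

theorem repr_diagOp (f : (diagOp b a).domain) (j : ι) :
    b.repr (diagOp b a f) j = a j * b.repr (f : H) j :=
  (mem_graph_diagOp b a).1 ((diagOp b a).mem_graph f) j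

theorem mem_diagOp_domain {f g : H} (h : ∀ j, b.repr g j = a j * b.repr f j) :
    f ∈ (diagOp b a).domain :=
  LinearPMap.mem_domain_of_mem_graph ((mem_graph_diagOp b a).2 h)

theorem isClosed_diagOp : (diagOp b a).IsClosed := by
  have : ((diagOp b a).graph : Set (H × H)) =
      ⋂ j, {p | b.repr p.2 j = a j * b.repr p.1 j} := by
    ext ⟨f, g⟩
    simpa using mem_graph_diagOp b a
  rw [LinearPMap.IsClosed, this]
  refine isClosed_iInter fun j => isClosed_eq ((continuous_repr b j).comp continuous_snd) ?_
  exact continuous_const.mul ((continuous_repr b j).comp continuous_fst)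

theorem basis_mem_graph (j : ι) : (b j, a j • b j) ∈ (diagOp b a).graph := by
  classical
  refine (mem_graph_diagOp b a).2 fun l => ?_
  rw [repr_smul_apply, repr_basis]
  by_cases hl : l = j
  · rw [hl]
  · simp [hl]

theorem dense_diagOp_domain : Dense ((diagOp b a).domain : Set H) := by
  have h1 : Submodule.span ℂ (Set.range b) ≤ (diagOp b a).domain := by
    rw [Submodule.span_le]
    rintro _ ⟨j, rfl⟩
    exact LinearPMap.mem_domain_of_mem_graph (basis_mem_graph b a j)
  have h2 : Dense (Submodule.span ℂ (Set.range b) : Set H) := by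
    rw [Submodule.dense_iff_topologicalClosure_eq_top]
    exact b.dense_span
  exact h2.mono h1

theorem smul_diagOp {c : ℂ} (hc : c ≠ 0) :
    c • diagOp b a = diagOp b fun j => c * a j := by
  refine LinearPMap.eq_of_eq_graph ?_
  ext ⟨f, g⟩
  rw [mem_graph_diagOp]
  constructor
  · intro h j
    obtain ⟨y, rfl, rfl⟩ := (LinearPMap.mem_graph_iff _).1 h
    rw [LinearPMap.smul_apply, repr_smul_apply, mul_assoc]
    congr 1
    exact repr_diagOp b a y j
  · intro h
    have hf : f ∈ (diagOp b a).domain := mem_diagOp_domain b a (g := c⁻¹ • g) fun j => by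
      rw [repr_smul_apply, h, mul_assoc, inv_mul_cancel_left₀ hc]
    refine (LinearPMap.mem_graph_iff _).2 ⟨⟨f, hf⟩, rfl, repr_injective b fun j => ?_⟩
    rw [LinearPMap.smul_apply, repr_smul_apply, h, mul_assoc]
    congr 1
    exact repr_diagOp b a ⟨f, hf⟩ j

/-- A maximal diagonal operator with real eigenvalues is self-adjoint. -/
theorem isSelfAdjoint_diagOp [CompleteSpace H] (ha : ∀ j, (starRingEnd ℂ) (a j) = a j) :
    IsSelfAdjoint (diagOp b a) := by
  rw [LinearPMap.isSelfAdjoint_def]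
  refine LinearPMap.eq_of_eq_graph ?_
  rw [LinearPMap.adjoint_graph_eq_graph_adjoint (dense_diagOp_domain b a)]
  ext ⟨y, w⟩
  rw [Submodule.mem_adjoint_iff, mem_graph_diagOp]
  constructor
  · intro h j
    have h2 := h _ _ (basis_mem_graph b a j)
    rw [inner_smul_left, ← b.repr_apply_apply, ← b.repr_apply_apply, sub_eq_zero] at h2
    rw [← h2, ha]
  · intro h f g hfg
    rw [mem_graph_diagOp] at hfg
    rw [sub_eq_zero, ← b.tsum_inner_mul_inner g y, ← b.tsum_inner_mul_inner f w]
    refine tsum_congr fun j => ?_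
    rw [← b.repr_apply_apply, ← b.repr_apply_apply, h, ← inner_conj_symm, ← b.repr_apply_apply,
      ← inner_conj_symm f, ← b.repr_apply_apply, hfg, map_mul, ha]
    ring

/-! ### The spectrum of a diagonal operator -/

theorem repr_shift (z : ℂ) (f : (diagOp b a).domain) (j : ι) :
    b.repr (shift (diagOp b a) z f) j = (z - a j) * b.repr (f : H) j := by
  rw [shift, repr_sub_apply, repr_smul_apply, repr_diagOp, sub_mul]

/-- If `z` is not an eigenvalue, then a bounded diagonal operator with the eigenvalues
`(z - a j)⁻¹` is the resolvent at `z`. -/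
theorem isResolvent_diagOp {z : ℂ} (hz : ∀ j, z - a j ≠ 0) {A : H →L[ℂ] H}
    (hA : ∀ f j, b.repr (A f) j = (z - a j)⁻¹ * b.repr f j) :
    IsResolvent (diagOp b a) z A := by
  have hl : ∀ x : (diagOp b a).domain, A (shift (diagOp b a) z x) = x := fun x =>
    repr_injective b fun j => by rw [hA, repr_shift, inv_mul_cancel_left₀ (hz j)]
  refine ⟨⟨fun x y hxy => ?_, fun g => ?_⟩, hl⟩
  · rw [Subtype.ext_iff, ← hl x, ← hl y, hxy]
  · have hd : A g ∈ (diagOp b a).domain := mem_diagOp_domain b a (g := z • A g - g) fun j => by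
      rw [repr_sub_apply, repr_smul_apply, hA]
      have := hz j
      field_simp
      ring
    refine ⟨⟨A g, hd⟩, repr_injective b fun j => ?_⟩
    rw [repr_shift, hA, mul_inv_cancel_left₀ (hz j)]

theorem mem_resolventSet_diagOp {z : ℂ} {δ : ℝ} (hδ : 0 < δ) (hz : ∀ j, δ ≤ ‖z - a j‖) :
    z ∈ resolventSet (diagOp b a) := by
  obtain ⟨A, hA⟩ := exists_bounded_diag b (m := fun j => (z - a j)⁻¹) (C := δ⁻¹) fun j => by
    rw [norm_inv]
    exact inv_anti₀ hδ (hz j)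
  refine ⟨A, isResolvent_diagOp b a (fun j h0 => ?_) hA⟩
  have := hz j
  rw [h0, norm_zero] at this
  linarith

theorem mem_pointSpectrum_diagOp (j : ι) : a j ∈ pointSpectrum (diagOp b a) := by
  classical
  intro hinj
  have hd := LinearPMap.mem_domain_of_mem_graph (basis_mem_graph b a j)
  have h1 : shift (diagOp b a) (a j) ⟨b j, hd⟩ = shift (diagOp b a) (a j) 0 :=
    repr_injective b fun l => by
      rw [repr_shift, repr_shift, repr_basis]
      by_cases hl : l = j
      · simp [hl]
      · simp [hl]
  have h2 := congrArg (fun x : (diagOp b a).domain => b.repr (x : H) j) (hinj h1)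
  simp [repr_basis b] at h2

theorem pointSpectrum_subset_spectrum (T : H →ₗ.[ℂ] H) : pointSpectrum T ⊆ spectrum T :=
  fun _ hz ⟨_, hA⟩ => hz hA.1.1

/-- If the eigenvalues form a closed set, then they are the whole spectrum. -/
theorem spectrum_diagOp (ha : IsClosed (Set.range a)) :
    spectrum (diagOp b a) = Set.range a ∧ pointSpectrum (diagOp b a) = Set.range a := by
  have h1 : Set.range a ⊆ pointSpectrum (diagOp b a) := by
    rintro _ ⟨j, rfl⟩
    exact mem_pointSpectrum_diagOp b a j
  have h2 := pointSpectrum_subset_spectrum (diagOp b a)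
  have h3 : spectrum (diagOp b a) ⊆ Set.range a := by
    intro z hz
    by_contra hn
    obtain ⟨δ, hδ, hball⟩ := Metric.mem_nhds_iff.1 (ha.isOpen_compl.mem_nhds hn)
    refine hz (mem_resolventSet_diagOp b a hδ fun j => ?_)
    by_contra! hlt
    have hmem : a j ∈ Metric.ball z δ := by rwa [mem_ball_iff_norm, norm_sub_rev]
    exact hball hmem ⟨j, rfl⟩
  exact ⟨h3.antisymm (h1.trans h2), (h2.trans h3).antisymm h1⟩

theorem resolvent_eq {T : H →ₗ.[ℂ] H} {z : ℂ} {A : H →L[ℂ] H} (hA : IsResolvent T z A) :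
    resolvent T z = A := by
  have hex : ∃ R : H →L[ℂ] H, IsResolvent T z R := ⟨A, hA⟩
  rw [resolvent, dif_pos hex]
  ext f
  obtain ⟨x, rfl⟩ := hA.1.2 f
  rw [hex.choose_spec.2, hA.2]

/-! ### Unitary groups with integral frequencies -/

/-- The frequencies are closed even if they are only some of the natural numbers. -/
theorem isClosed_range_I_mul_nat (n : ι → ℕ) :
    IsClosed (Set.range fun j => Complex.I * (n j : ℂ)) := by
  have h1 : IsClosedMap fun m : ℕ => Complex.I * (((m : ℝ) : ℝ) : ℂ) :=
    ((Homeomorph.mulLeft₀ Complex.I Complex.I_ne_zero).isClosedMap.comp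
      Complex.isometry_ofReal.isClosedEmbedding.isClosedMap).comp
      Nat.isClosedEmbedding_coe_real.isClosedMap
  have h2 := h1 (Set.range n) (isClosed_discrete _)
  rw [← Set.range_comp] at h2
  simpa [Function.comp_def] using h2

/-- The series `∑ e^{i n_j s} ⟨b_j, f⟩ b_j` converges, its sum being the image of `f` under a
bounded diagonal operator; so `tsum` does not take its junk value here. -/
theorem repr_tsum_exp (n : ι → ℕ) (s : ℝ) (f : H) (j : ι) :
    b.repr (∑' j, (Complex.exp (Complex.I * (n j : ℂ) * (s : ℂ)) * inner ℂ (b j) f) • b j) j =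
      Complex.exp (Complex.I * (n j : ℂ) * (s : ℂ)) * b.repr f j := by
  have hn : ∀ j, ‖Complex.exp (Complex.I * (n j : ℂ) * (s : ℂ))‖ ≤ 1 := fun j => by
    rw [Complex.norm_exp]
    simp
  obtain ⟨A, hA⟩ := exists_bounded_diag b hn
  have h1 := (b.hasSum_repr (A f)).tsum_eq
  simp only [hA, b.repr_apply_apply f] at h1
  rw [h1, hA, b.repr_apply_apply f]

variable {b} {n : ι → ℕ} {U : ℝ → H → H}

/-- The generator of the group `U s` with `U s b_j = e^{i n_j s} b_j` is the maximal diagonal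
operator with eigenvalues `i n_j`. -/
theorem isGenerator_diagOp
    (hU : ∀ s f j, b.repr (U s f) j = Complex.exp (Complex.I * (n j : ℂ) * (s : ℂ)) * b.repr f j) :
    IsGenerator U (diagOp b fun j => Complex.I * (n j : ℂ)) := by
  have hq : ∀ (f : H) (s : ℝ) j, b.repr ((s : ℂ)⁻¹ • (U s f - f)) j =
      (s : ℂ)⁻¹ * (Complex.exp (Complex.I * (n j : ℂ) * (s : ℂ)) - 1) * b.repr f j :=
    fun f s j => by
      rw [repr_smul_apply, repr_sub_apply, hU]
      ring
  have hlim : ∀ j, Tendsto (fun s : ℝ => (s : ℂ)⁻¹ *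
      (Complex.exp (Complex.I * (n j : ℂ) * (s : ℂ)) - 1)) (𝓝[≠] 0)
      (𝓝 (Complex.I * (n j : ℂ))) := fun j => by
    have hd : HasDerivAt (fun s : ℝ => Complex.exp (Complex.I * (n j : ℂ) * (s : ℂ)))
        (Complex.I * (n j : ℂ)) 0 := by
      have h1 : HasDerivAt (fun s : ℝ => Complex.I * (n j : ℂ) * (s : ℂ))
          (Complex.I * (n j : ℂ)) 0 := by
        simpa using (Complex.ofRealCLM.hasDerivAt (x := (0 : ℝ))).const_mul
          (Complex.I * (n j : ℂ))
      simpa using h1.cexp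
    have := hd.tendsto_slope_zero
    simpa [Complex.real_smul] using this
  intro f g
  rw [mem_graph_diagOp]
  constructor
  · intro h
    refine tendsto_of_tendsto_repr b (c := fun j => 2 * ‖b.repr g j‖) ?_ ?_ fun j => ?_
    · simpa [mul_pow] using (hasSum_norm_repr_sq b g).summable.mul_left (2 ^ 2)
    · filter_upwards [self_mem_nhdsWithin] with s hs j
      have hs0 : 0 < ‖(s : ℂ)‖ := by
        rw [norm_pos_iff]
        exact Complex.ofReal_ne_zero.2 hs
      have h1 : ‖Complex.exp (Complex.I * (n j : ℂ) * (s : ℂ)) - (1 : ℂ)‖ ≤ n j * ‖(s : ℂ)‖ := by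
        have := Real.norm_exp_I_mul_ofReal_sub_one_le (x := n j * s)
        simpa [mul_assoc] using this
      have h2 : ‖b.repr ((s : ℂ)⁻¹ • (U s f - f)) j‖ ≤ ‖b.repr g j‖ := by
        rw [hq, h, norm_mul, norm_mul _ (b.repr f j), norm_mul, norm_inv]
        refine mul_le_mul_of_nonneg_right ?_ (norm_nonneg _)
        rw [inv_mul_le_iff₀ hs0]
        simpa [mul_comm] using h1
      exact (norm_sub_le _ _).trans (by linarith)
    · simp only [hq, h]
      exact (hlim j).mul_const _
  · intro h j
    have h1 := ((continuous_repr b j).tendsto g).comp h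
    simp only [Function.comp_def, hq] at h1
    exact tendsto_nhds_unique h1 ((hlim j).mul_const _)

theorem continuous_of_repr_exp
    (hU : ∀ s f j, b.repr (U s f) j = Complex.exp (Complex.I * (n j : ℂ) * (s : ℂ)) * b.repr f j)
    (f : H) : Continuous fun s => U s f := by
  have hnorm : ∀ s j, ‖b.repr (U s f) j‖ = ‖b.repr f j‖ := fun s j => by
    rw [hU, norm_mul, Complex.norm_exp]
    simp
  refine continuous_iff_continuousAt.2 fun s => ?_
  refine tendsto_of_tendsto_repr b (c := fun j => 2 * ‖b.repr f j‖) ?_ ?_ fun j => ?_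
  · simpa [mul_pow] using (hasSum_norm_repr_sq b f).summable.mul_left (2 ^ 2)
  · refine Eventually.of_forall fun t j => (norm_sub_le _ _).trans ?_
    rw [hnorm, hnorm]
    linarith
  · simp only [hU]
    have : Continuous fun s : ℝ =>
        Complex.exp (Complex.I * (n j : ℂ) * (s : ℂ)) * b.repr f j := by fun_prop
    exact this.tendsto s

/-- The resolvent as a Laplace transform over one period. -/
theorem resolvent_diagOp [CompleteSpace H]
    (hU : ∀ s f j, b.repr (U s f) j = Complex.exp (Complex.I * (n j : ℂ) * (s : ℂ)) * b.repr f j)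
    {z : ℂ} (hz : z ∉ Set.range (fun m : ℤ => Complex.I * (m : ℂ))) (f : H) :
    IntervalIntegrable (fun s : ℝ => Complex.exp (-z * s) • U s f) volume 0 (2 * Real.pi) ∧
      resolvent (diagOp b fun j => Complex.I * (n j : ℂ)) z f =
        (1 - Complex.exp (-2 * Real.pi * z))⁻¹ •
          ∫ s in (0 : ℝ)..(2 * Real.pi), Complex.exp (-z * s) • U s f := by
  have hz' : ∀ j, z - Complex.I * (n j : ℂ) ≠ 0 := fun j h0 =>
    hz ⟨n j, by simpa using (sub_eq_zero.1 h0).symm⟩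
  have hcont : Continuous fun s : ℝ => Complex.exp (-z * s) • U s f :=
    (by fun_prop : Continuous fun s : ℝ => Complex.exp (-z * s)).smul
      (continuous_of_repr_exp hU f)
  have hint := hcont.intervalIntegrable (μ := volume) 0 (2 * Real.pi)
  refine ⟨hint, ?_⟩
  have hres : z ∈ resolventSet (diagOp b fun j => Complex.I * (n j : ℂ)) := by
    by_contra hn
    have := (spectrum_diagOp b _ (isClosed_range_I_mul_nat n)).1.subset hn
    obtain ⟨j, hj⟩ := this
    exact hz' j (sub_eq_zero.2 hj.symm)
  obtain ⟨A, hA⟩ := hres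
  rw [resolvent_eq hA]
  obtain ⟨x, rfl⟩ : ∃ x, shift (diagOp b fun j => Complex.I * (n j : ℂ)) z x = f := hA.1.2 f
  rw [hA.2]
  refine repr_injective b fun j => ?_
  have hexp : 1 - Complex.exp (-2 * Real.pi * z) ≠ 0 := by
    intro h0
    obtain ⟨m, hm⟩ := Complex.exp_eq_one_iff.1 (sub_eq_zero.1 h0).symm
    refine hz ⟨-m, ?_⟩
    have hpi : (2 * Real.pi : ℂ) ≠ 0 := by simp [Real.pi_ne_zero]
    refine mul_left_cancel₀ hpi ?_
    push_cast
    linear_combination hm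
  have hcoef : b.repr (∫ s in (0 : ℝ)..(2 * Real.pi), Complex.exp (-z * s) •
      U s (shift (diagOp b fun j => Complex.I * (n j : ℂ)) z x)) j =
      ∫ s in (0 : ℝ)..(2 * Real.pi), b.repr (Complex.exp (-z * s) •
      U s (shift (diagOp b fun j => Complex.I * (n j : ℂ)) z x)) j := by
    simp only [b.repr_apply_apply]
    exact ((innerSL ℂ (b j)).intervalIntegral_comp_comm hint).symm
  have hprod : ∀ s : ℝ, Complex.exp (-z * s) * Complex.exp (Complex.I * (n j : ℂ) * (s : ℂ)) =
      Complex.exp (-(z - Complex.I * (n j : ℂ)) * s) := fun s => by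
    rw [← Complex.exp_add]
    ring_nf
  have hper : Complex.exp (-(z - Complex.I * (n j : ℂ)) * (2 * Real.pi : ℝ)) =
      Complex.exp (-2 * Real.pi * z) := by
    have : -(z - Complex.I * (n j : ℂ)) * (2 * Real.pi : ℝ) =
        -2 * Real.pi * z + (n j : ℂ) * (2 * Real.pi * Complex.I) := by
      push_cast
      ring
    rw [this, Complex.exp_add, Complex.exp_nat_mul_two_pi_mul_I, mul_one]
  rw [repr_smul_apply, hcoef]
  simp only [repr_smul_apply, hU, ← mul_assoc, hprod]
  rw [intervalIntegral.integral_mul_const, integral_exp_mul_complex (neg_ne_zero.2 (hz' j)), hper,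
    repr_shift]
  have h1 := hz' j
  simp only [Complex.ofReal_zero, mul_zero, Complex.exp_zero]
  generalize Complex.exp (-2 * Real.pi * z) = w at hexp ⊢
  field_simp
  ring

end Unbounded

namespace Dunkl

variable {N : ℕ} {P : Finset (Space N)} {k : Space N → ℝ≥0}

/-! ### Positive roots -/

theorem norm_sq_of_inner {u : Space N} (hu : inner ℝ u u = 2) : ‖u‖ ^ 2 = 2 := by
  rw [← real_inner_self_eq_norm_sq, hu]

theorem refl_apply {u : Space N} (hu : inner ℝ u u = 2) (x : Space N) :
    refl u x = x - inner ℝ u x • u := by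
  rw [Submodule.reflection_orthogonal_apply, Submodule.reflection_singleton_apply]
  simp only [norm_sq_of_inner hu, RCLike.ofReal_real_eq_id, id_eq]
  module

theorem refl_refl (u x : Space N) : refl u (refl u x) = x :=
  Submodule.reflection_reflection _ x

/-- The properties of the positive subsystem `P` and the multiplicities `k` that the analysis
below rests on. They speak of the positive roots only: reflections permute them up to signs. -/
structure IsPositiveRoots (P : Finset (Space N)) (k : Space N → ℝ≥0) : Prop where
  inner_self : ∀ u ∈ P, inner ℝ u u = 2
  exists_pos : ∃ v : Space N, ∀ u ∈ P, 0 < inner ℝ u v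
  refl_mem : ∀ u ∈ P, ∀ η ∈ P, refl u η ∈ P ∨ -refl u η ∈ P
  mult_refl : ∀ u ∈ P, ∀ η ∈ P, k (refl u η) = k η
  mult_neg : ∀ η ∈ P, k (-η) = k η
  mult_neg_refl : ∀ u ∈ P, ∀ η ∈ P, k (-refl u η) = k η

theorem IsPositiveSubsystem.isPositiveRoots {R : Finset (Space N)} (hR : IsRootSystem R)
    (hP : IsPositiveSubsystem R P) (hk : IsMultiplicity R k) : IsPositiveRoots P k := by
  obtain ⟨v, hv, hP⟩ := hP
  have hmem : ∀ u ∈ R, ∀ η ∈ R, refl u η ∈ R := fun u hu η hη => by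
    have : refl u η ∈ refl u '' (R : Set (Space N)) := ⟨η, hη, rfl⟩
    rw [hR.refl_image u hu] at this
    exact this
  have hneg : ∀ η : Space N, refl η η = -η := fun η => by
    rw [Submodule.reflection_mem_subspace_orthogonalComplement_eq_neg]
    rw [Submodule.orthogonal_orthogonal]
    exact Submodule.mem_span_singleton_self η
  have hknegR : ∀ η ∈ R, k (-η) = k η := fun η hη => by
    rw [← hneg η]
    exact hk _ (Subgroup.subset_closure ⟨η, hη, rfl⟩) η hη
  have hkR : ∀ u ∈ R, ∀ η ∈ R, k (refl u η) = k η := fun u hu η hη =>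
    hk _ (Subgroup.subset_closure ⟨u, hu, rfl⟩) η hη
  refine ⟨fun u hu => hR.inner_self u ((hP u).1 hu).1, ⟨v, fun u hu => ((hP u).1 hu).2⟩, ?_, ?_,
    fun η hη => hknegR η ((hP η).1 hη).1, ?_⟩
  · intro u hu η hη
    have h1 := hmem u ((hP u).1 hu).1 η ((hP η).1 hη).1
    rcases lt_or_gt_of_ne (hv _ h1) with h | h
    · right
      refine (hP _).2 ⟨?_, by rw [inner_neg_left]; linarith⟩
      rw [← hneg]
      exact hmem _ h1 _ h1
    · exact Or.inl ((hP _).2 ⟨h1, h⟩)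
  · exact fun u hu η hη => hkR u ((hP u).1 hu).1 η ((hP η).1 hη).1
  · intro u hu η hη
    rw [hknegR _ (hmem u ((hP u).1 hu).1 η ((hP η).1 hη).1)]
    exact hkR u ((hP u).1 hu).1 η ((hP η).1 hη).1

namespace IsPositiveRoots

theorem neg_notMem (h : IsPositiveRoots P k) {η : Space N} (hη : η ∈ P) : -η ∉ P := by
  obtain ⟨v, hv⟩ := h.exists_pos
  intro hn
  have h1 := hv _ hn
  rw [inner_neg_left] at h1
  linarith [hv η hη]

theorem ne_zero (h : IsPositiveRoots P k) {η : Space N} (hη : η ∈ P) : η ≠ 0 := by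
  rintro rfl
  simpa using h.inner_self _ hη

/-- Even expressions in the roots, weighted by the multiplicities, may be reindexed along a
reflection, since this permutes the positive roots up to signs. -/
@[to_additive]
theorem prod_refl (h : IsPositiveRoots P k) {M : Type*} [CommMonoid M] {u : Space N} (hu : u ∈ P)
    (F : ℝ≥0 → Space N → M) (hF : ∀ c x, F c (-x) = F c x) :
    ∏ η ∈ P, F (k η) (refl u η) = ∏ η ∈ P, F (k η) η := by
  classical
  -- the involution of the positive roots which is `σ_u` up to signs
  let s : Space N → Space N := fun η => if refl u η ∈ P then refl u η else -refl u η
  have hs : ∀ η ∈ P, s η ∈ P := fun η hη => by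
    by_cases h1 : refl u η ∈ P
    · simp [s, h1]
    · simpa [s, h1] using (h.refl_mem u hu η hη).resolve_left h1
  have hss : ∀ η ∈ P, s (s η) = η := fun η hη => by
    by_cases h1 : refl u η ∈ P
    · simp [s, h1, hη]
    · simp [s, h1, h.neg_notMem hη]
  refine Finset.prod_nbij' s s hs hs hss hss fun η hη => ?_
  by_cases h1 : refl u η ∈ P
  · simp only [s, h1, if_true, h.mult_refl u hu η hη]
  · simp only [s, h1, if_false, h.mult_neg_refl u hu η hη, hF]

end IsPositiveRoots

/-! ### Reflections and divided differences of polynomials -/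

open MvPolynomial

theorem real_inner_eq_sum (x y : Space N) : inner ℝ x y = ∑ i, x i * y i := by
  rw [PiLp.inner_apply]
  simp [mul_comm]

/-- Real polynomials are determined by their values on Euclidean space. -/
theorem ext_eval {p q : MvPolynomial (Fin N) ℝ}
    (h : ∀ x : Space N, eval (fun i => x i) p = eval (fun i => x i) q) : p = q :=
  MvPolynomial.funext fun x => h (WithLp.toLp 2 x)

theorem eval_linForm (η x : Space N) : eval (fun i => x i) (linForm η) = inner ℝ η x := by
  simp [linForm, real_inner_eq_sum]

theorem reflPoly_X {u : Space N} (hu : inner ℝ u u = 2) (i : Fin N) :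
    reflPoly u (X i) = X i - C (u i) * linForm u := by
  simp [reflPoly, norm_sq_of_inner hu]

theorem eval_reflPoly {u : Space N} (hu : inner ℝ u u = 2) (x : Space N)
    (p : MvPolynomial (Fin N) ℝ) :
    eval (fun i => x i) (reflPoly u p) = eval (fun i => refl u x i) p := by
  induction p using MvPolynomial.induction_on with
  | C a => simp [reflPoly]
  | add p q hp hq => simp only [map_add, hp, hq]
  | mul_X p i hp =>
    rw [map_mul, map_mul, hp, map_mul, reflPoly_X hu, refl_apply hu]
    simp [eval_linForm, mul_comm]

theorem reflPoly_reflPoly {u : Space N} (hu : inner ℝ u u = 2) (p : MvPolynomial (Fin N) ℝ) :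
    reflPoly u (reflPoly u p) = p :=
  ext_eval fun x => by rw [eval_reflPoly hu, eval_reflPoly hu, refl_refl]

theorem inner_refl_self (u η : Space N) :
    inner ℝ (refl u η) (refl u η) = inner ℝ η η :=
  (refl u).inner_map_map η η

theorem linForm_refl {u : Space N} (hu : inner ℝ u u = 2) (η : Space N) :
    linForm (refl u η) = reflPoly u (linForm η) :=
  ext_eval fun x => by
    rw [eval_reflPoly hu, eval_linForm, eval_linForm, ← (refl u).inner_map_map η, refl_refl]

theorem linForm_neg (η : Space N) : linForm (-η) = -linForm η :=
  ext_eval fun x => by simp [eval_linForm]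

theorem linForm_ne_zero {η : Space N} (hη : η ≠ 0) : linForm η ≠ 0 := fun h => by
  have := congrArg (eval fun i => η i) h
  rw [eval_linForm] at this
  simp [hη] at this

theorem divDiff_eq_of_mul_eq {η : Space N} (hη : η ≠ 0) {p q : MvPolynomial (Fin N) ℝ}
    (h : linForm η * q = p - reflPoly η p) : divDiff η p = q :=
  mul_left_cancel₀ (linForm_ne_zero hη) ((linForm_mul_divDiff η p).trans h.symm)

theorem reflPoly_neg (η : Space N) : reflPoly (-η) = reflPoly η := by
  refine MvPolynomial.algHom_ext fun i => ?_
  simp only [reflPoly, aeval_X, linForm_neg, norm_neg, PiLp.neg_apply, mul_neg, map_neg, neg_mul,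
    neg_neg]

theorem divDiff_neg {η : Space N} (hη : η ≠ 0) (p : MvPolynomial (Fin N) ℝ) :
    divDiff (-η) p = -divDiff η p :=
  divDiff_eq_of_mul_eq (neg_ne_zero.2 hη) (by
    rw [linForm_neg, neg_mul_neg, linForm_mul_divDiff, reflPoly_neg])

theorem ne_zero_of_inner {u : Space N} (hu : inner ℝ u u = 2) : u ≠ 0 := by
  rintro rfl
  simp at hu

theorem reflPoly_reflPoly_comm {u η : Space N} (hu : inner ℝ u u = 2) (hη : inner ℝ η η = 2)
    (p : MvPolynomial (Fin N) ℝ) :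
    reflPoly u (reflPoly η p) = reflPoly (refl u η) (reflPoly u p) :=
  ext_eval fun x => by
    have h2 : inner ℝ (refl u η) (refl u η) = 2 := by rw [inner_refl_self, hη]
    rw [eval_reflPoly hu, eval_reflPoly hη, eval_reflPoly h2, eval_reflPoly hu]
    congr 2
    have : refl η (refl u x) = refl u (refl (refl u η) x) := by
      rw [refl_apply hη, refl_apply h2, map_sub, map_smul, refl_refl]
      congr 2
      rw [← (refl u).inner_map_map η, refl_refl]
    rw [this]

theorem reflPoly_divDiff {u η : Space N} (hu : inner ℝ u u = 2) (hη : inner ℝ η η = 2)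
    (p : MvPolynomial (Fin N) ℝ) :
    reflPoly u (divDiff η p) = divDiff (refl u η) (reflPoly u p) := by
  have h2 : inner ℝ (refl u η) (refl u η) = 2 := by rw [inner_refl_self, hη]
  symm
  refine divDiff_eq_of_mul_eq (ne_zero_of_inner h2) ?_
  rw [linForm_refl hu, ← map_mul, linForm_mul_divDiff, map_sub, reflPoly_reflPoly_comm hu hη]

/-- Divided differences are invariant under the reflection. -/
theorem reflPoly_divDiff_self {η : Space N} (hη : inner ℝ η η = 2)
    (p : MvPolynomial (Fin N) ℝ) : reflPoly η (divDiff η p) = divDiff η p := by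
  have h0 := ne_zero_of_inner hη
  have h1 : refl η η = -η := by rw [refl_apply hη, hη]; module
  rw [reflPoly_divDiff hη hη, h1, divDiff_neg h0]
  have := linForm_mul_divDiff η (reflPoly η p)
  rw [reflPoly_reflPoly hη] at this
  refine mul_left_cancel₀ (linForm_ne_zero h0) ?_
  rw [mul_neg, this, linForm_mul_divDiff]
  ring

theorem divDiff_X_mul {η : Space N} (hη : inner ℝ η η = 2) (j : Fin N)
    (p : MvPolynomial (Fin N) ℝ) :
    divDiff η (X j * p) = X j * divDiff η p + η j • reflPoly η p := by
  refine divDiff_eq_of_mul_eq (ne_zero_of_inner hη) ?_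
  rw [map_mul, reflPoly_X hη, smul_eq_C_mul]
  linear_combination X j * linForm_mul_divDiff η p

/-! ### The Dunkl operators -/

theorem dunklOp_apply (i : Fin N) (p : MvPolynomial (Fin N) ℝ) :
    dunklOp P k i p = pderiv i p + ∑ η ∈ P, ((k η : ℝ) * η i) • divDiff η p := by
  simp [dunklOp]

theorem dunklOp_C (h : IsPositiveRoots P k) (i : Fin N) (a : ℝ) : dunklOp P k i (C a) = 0 := by
  rw [dunklOp_apply, pderiv_C, zero_add]
  refine Finset.sum_eq_zero fun η hη => ?_
  rw [divDiff_eq_of_mul_eq (q := 0) (h.ne_zero hη) (by simp [reflPoly]), smul_zero]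

/-- The commutator of a Dunkl operator with a coordinate multiplication. -/
theorem dunklOp_X_mul (h : IsPositiveRoots P k) (i j : Fin N) (p : MvPolynomial (Fin N) ℝ) :
    dunklOp P k i (X j * p) = X j * dunklOp P k i p + (if i = j then (1 : ℝ) else 0) • p +
      ∑ η ∈ P, ((k η : ℝ) * η i * η j) • reflPoly η p := by
  have h1 : ∑ η ∈ P, ((k η : ℝ) * η i) • divDiff η (X j * p) =
      X j * ∑ η ∈ P, ((k η : ℝ) * η i) • divDiff η p +
        ∑ η ∈ P, ((k η : ℝ) * η i * η j) • reflPoly η p := by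
    rw [Finset.mul_sum, ← Finset.sum_add_distrib]
    refine Finset.sum_congr rfl fun η hη => ?_
    rw [divDiff_X_mul (h.inner_self η hη), smul_add, mul_smul_comm, smul_smul]
  rw [dunklOp_apply, dunklOp_apply, h1, pderiv_mul, pderiv_X]
  by_cases hij : i = j
  · subst hij
    simp
    ring
  · simp [hij, Ne.symm hij]
    ring

theorem reflPoly_pderiv {u : Space N} (hu : inner ℝ u u = 2) (i : Fin N)
    (p : MvPolynomial (Fin N) ℝ) :
    reflPoly u (pderiv i p) = pderiv i (reflPoly u p) -
      u i • ∑ j, u j • pderiv j (reflPoly u p) := by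
  -- Both sides are derivations along `reflPoly u`; the one on the right is `D ∘ reflPoly u`.
  let D : Derivation ℝ (MvPolynomial (Fin N) ℝ) (MvPolynomial (Fin N) ℝ) :=
    pderiv i - u i • ∑ j, u j • pderiv j
  have hDf : ∀ q, D q = pderiv i q - u i • ∑ j, u j • pderiv j q := fun q => by
    have hs : (∑ j, u j • pderiv j : Derivation ℝ (MvPolynomial (Fin N) ℝ) _) q =
        ∑ j, u j • pderiv j q := by
      rw [← Derivation.coeFnAddMonoidHom_apply, map_sum, Finset.sum_apply]
      rfl
    simp [D, hs]
  rw [← hDf]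
  have hlin : ∀ j, pderiv j (linForm u) = C (u j) := fun j => by
    simp [linForm, Pi.single_apply, pderiv_X]
  have hDlin : D (linForm u) = -C (u i) := by
    rw [hDf]
    simp only [hlin, smul_eq_C_mul, ← map_mul, ← map_sum, ← real_inner_eq_sum, hu]
    rw [← map_sub, ← map_neg]
    ring_nf
  have hDX : ∀ j, D (X j) = (if i = j then 1 else 0) - C (u i * u j) := fun j => by
    rw [hDf]
    by_cases hij : i = j
    · simp [hij, pderiv_X, Pi.single_apply, smul_eq_C_mul]
    · simp [hij, Ne.symm hij, pderiv_X, Pi.single_apply, smul_eq_C_mul]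
  induction p using MvPolynomial.induction_on with
  | C a => simp [reflPoly]
  | add p q hp hq => simp only [map_add, hp, hq]
  | mul_X p j hp =>
    rw [pderiv_mul, map_add, map_mul, map_mul, hp, map_mul (reflPoly u) p, D.leibniz,
      reflPoly_X hu, map_sub, D.leibniz, hDX, hDlin]
    have hC : D (C (u j)) = 0 := by
      rw [← algebraMap_eq]
      exact D.map_algebraMap _
    have hP : reflPoly u (pderiv i (X j)) = if i = j then 1 else 0 := by
      by_cases hij : i = j
      · simp [hij, pderiv_X]
      · simp [hij, Ne.symm hij, pderiv_X]
    rw [hC, hP]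
    simp only [smul_eq_mul, map_mul]
    ring

/-- Equivariance of the Dunkl operators: conjugation by a reflection `σ_u` maps `T_i = T_{e_i}` to
`T_{σ_u e_i} = T_i - u_i T_u`. -/
theorem reflPoly_dunklOp (h : IsPositiveRoots P k) {u : Space N} (hu : u ∈ P) (i : Fin N)
    (p : MvPolynomial (Fin N) ℝ) :
    reflPoly u (dunklOp P k i p) = dunklOp P k i (reflPoly u p) -
      u i • ∑ j, u j • dunklOp P k j (reflPoly u p) := by
  have hu2 := h.inner_self u hu
  have h1 : reflPoly u (∑ η ∈ P, ((k η : ℝ) * η i) • divDiff η p) =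
      ∑ η ∈ P, ((k η : ℝ) * (refl u η) i) • divDiff η (reflPoly u p) := by
    rw [map_sum, ← h.sum_refl hu fun c η => ((c : ℝ) * (refl u η) i) • divDiff η (reflPoly u p)]
    · refine Finset.sum_congr rfl fun η hη => ?_
      rw [map_smul, reflPoly_divDiff hu2 (h.inner_self η hη), refl_refl]
    · intro c x
      rcases eq_or_ne x 0 with rfl | hx
      · simp
      · rw [divDiff_neg hx, map_neg, PiLp.neg_apply, smul_neg, mul_neg, neg_smul, neg_neg]
  have h2 : ∑ η ∈ P, ((k η : ℝ) * (refl u η) i) • divDiff η (reflPoly u p) =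
      ∑ η ∈ P, ((k η : ℝ) * η i) • divDiff η (reflPoly u p) -
      u i • ∑ j, u j • ∑ η ∈ P, ((k η : ℝ) * η j) • divDiff η (reflPoly u p) := by
    simp only [Finset.smul_sum]
    rw [Finset.sum_comm, ← Finset.sum_sub_distrib]
    refine Finset.sum_congr rfl fun η hη => ?_
    rw [refl_apply hu2, real_inner_eq_sum]
    simp only [PiLp.sub_apply, PiLp.smul_apply, smul_eq_mul, smul_smul]
    rw [← Finset.sum_smul, ← sub_smul]
    congr 1
    rw [mul_sub, Finset.sum_mul, Finset.mul_sum]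
    congr 1
    exact Finset.sum_congr rfl fun j _ => by ring
  simp only [dunklOp_apply, map_add, h1, h2, reflPoly_pderiv hu2, smul_add,
    Finset.sum_add_distrib]
  ring

/-- The relation `σ_η T_η = -T_η σ_η`. -/
theorem sum_smul_reflPoly_dunklOp (h : IsPositiveRoots P k) {u : Space N} (hu : u ∈ P)
    (p : MvPolynomial (Fin N) ℝ) :
    ∑ i, u i • reflPoly u (dunklOp P k i p) = -∑ i, u i • dunklOp P k i (reflPoly u p) := by
  have h1 : ∑ i, u i * u i = 2 := by rw [← real_inner_eq_sum, h.inner_self u hu]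
  simp only [reflPoly_dunklOp h hu, smul_sub, Finset.sum_sub_distrib, smul_smul]
  rw [← Finset.sum_smul, h1]
  module

/-- The commutator of the Dunkl Laplacian with a coordinate multiplication. -/
theorem dunklLaplacian_X_mul (h : IsPositiveRoots P k) (j : Fin N) (p : MvPolynomial (Fin N) ℝ) :
    dunklLaplacian P k (X j * p) = X j * dunklLaplacian P k p + (2 : ℝ) • dunklOp P k j p := by
  have hL : ∀ q, dunklLaplacian P k q = ∑ i, dunklOp P k i (dunklOp P k i q) := fun q => by
    simp [dunklLaplacian]
  have h1 : ∀ i, dunklOp P k i (dunklOp P k i (X j * p)) =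
      X j * dunklOp P k i (dunklOp P k i p) +
      (2 * (if i = j then (1 : ℝ) else 0)) • dunklOp P k i p +
      ∑ η ∈ P, ((k η : ℝ) * η j) • (η i • reflPoly η (dunklOp P k i p) +
        η i • dunklOp P k i (reflPoly η p)) := fun i => by
    rw [dunklOp_X_mul h, map_add, map_add, dunklOp_X_mul h, map_smul, map_sum]
    have : ∑ η ∈ P, ((k η : ℝ) * η j) • (η i • reflPoly η (dunklOp P k i p) +
        η i • dunklOp P k i (reflPoly η p)) =
        ∑ η ∈ P, ((k η : ℝ) * η i * η j) • reflPoly η (dunklOp P k i p) +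
        ∑ η ∈ P, dunklOp P k i (((k η : ℝ) * η i * η j) • reflPoly η p) := by
      rw [← Finset.sum_add_distrib]
      refine Finset.sum_congr rfl fun η _ => ?_
      rw [map_smul]
      module
    rw [this]
    module
  simp only [hL, h1, Finset.sum_add_distrib, ← Finset.mul_sum]
  rw [Finset.sum_comm]
  have h2 : ∑ η ∈ P, ∑ i, ((k η : ℝ) * η j) • (η i • reflPoly η (dunklOp P k i p) +
        η i • dunklOp P k i (reflPoly η p)) = 0 := by
    refine Finset.sum_eq_zero fun η hη => ?_
    rw [← Finset.smul_sum, Finset.sum_add_distrib, sum_smul_reflPoly_dunklOp h hη, neg_add_cancel,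
      smul_zero]
  rw [h2, add_zero]
  simp

/-- The Dunkl operators commute. By the Jacobi identity and the equivariance, the commutator of
`T_i` and `T_j` commutes with all coordinate multiplications, and it annihilates constants. -/
theorem dunklOp_comm (h : IsPositiveRoots P k) (i j : Fin N) (p : MvPolynomial (Fin N) ℝ) :
    dunklOp P k i (dunklOp P k j p) = dunklOp P k j (dunklOp P k i p) := by
  induction p using MvPolynomial.induction_on with
  | C a => simp [dunklOp_C h]
  | add p q hp hq => simp only [map_add, hp, hq]
  | mul_X p l hp =>
    -- Apart from the term with `X l`, the right-hand side is symmetric in `i` and `j`.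
    have key : ∀ i j, dunklOp P k i (dunklOp P k j (X l * p)) =
        X l * dunklOp P k i (dunklOp P k j p) + (if i = l then (1 : ℝ) else 0) • dunklOp P k j p +
        (if j = l then (1 : ℝ) else 0) • dunklOp P k i p +
        ∑ η ∈ P, ((k η : ℝ) * η l) • (η i • dunklOp P k j (reflPoly η p) +
          η j • dunklOp P k i (reflPoly η p) -
          (η i * η j) • ∑ m, η m • dunklOp P k m (reflPoly η p)) := fun i j => by
      rw [dunklOp_X_mul h, map_add, map_add, dunklOp_X_mul h, map_smul, map_sum]
      have : ∑ η ∈ P, ((k η : ℝ) * η l) • (η i • dunklOp P k j (reflPoly η p) +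
          η j • dunklOp P k i (reflPoly η p) -
          (η i * η j) • ∑ m, η m • dunklOp P k m (reflPoly η p)) =
          ∑ η ∈ P, ((k η : ℝ) * η i * η l) • reflPoly η (dunklOp P k j p) +
          ∑ η ∈ P, dunklOp P k i (((k η : ℝ) * η j * η l) • reflPoly η p) := by
        rw [← Finset.sum_add_distrib]
        refine Finset.sum_congr rfl fun η hη => ?_
        rw [map_smul, reflPoly_dunklOp h hη]
        module
      rw [this]
      module
    rw [mul_comm p, key, key, hp]
    have : ∀ η : Space N, η i • dunklOp P k j (reflPoly η p) +
          η j • dunklOp P k i (reflPoly η p) -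
          (η i * η j) • ∑ m, η m • dunklOp P k m (reflPoly η p) =
        η j • dunklOp P k i (reflPoly η p) + η i • dunklOp P k j (reflPoly η p) -
          (η j * η i) • ∑ m, η m • dunklOp P k m (reflPoly η p) := fun η => by module
    simp only [this]
    module

theorem dunklLaplacian_dunklOp (h : IsPositiveRoots P k) (j : Fin N)
    (p : MvPolynomial (Fin N) ℝ) :
    dunklLaplacian P k (dunklOp P k j p) = dunklOp P k j (dunklLaplacian P k p) := by
  simp only [dunklLaplacian, LinearMap.sum_apply, LinearMap.comp_apply, map_sum]
  refine Finset.sum_congr rfl fun i _ => ?_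
  rw [dunklOp_comm h i j p, dunklOp_comm h i j]

/-! ### The operator `e^{-Δ_k/4}` -/

theorem dunklLaplacian_pow_X_mul (h : IsPositiveRoots P k) (j : Fin N) (m : ℕ)
    (p : MvPolynomial (Fin N) ℝ) :
    (dunklLaplacian P k ^ (m + 1)) (X j * p) = X j * (dunklLaplacian P k ^ (m + 1)) p +
      (2 * (m + 1) : ℝ) • dunklOp P k j ((dunklLaplacian P k ^ m) p) := by
  induction m with
  | zero => simpa using dunklLaplacian_X_mul h j p
  | succ m ih =>
    have hs : ∀ n, dunklLaplacian P k ((dunklLaplacian P k ^ n) p) =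
        (dunklLaplacian P k ^ (n + 1)) p := fun n => by rw [pow_succ', Module.End.mul_apply]
    rw [pow_succ', Module.End.mul_apply, ih, map_add, map_smul, dunklLaplacian_X_mul h,
      dunklLaplacian_dunklOp h, Module.End.mul_apply, hs, hs]
    push_cast
    module

theorem dunklLaplacian_C (h : IsPositiveRoots P k) (a : ℝ) : dunklLaplacian P k (C a) = 0 := by
  simp [dunklLaplacian, dunklOp_C h]

/-- By induction on the degree: `Δ_k^m x_j = x_j Δ_k^m + 2 m T_j Δ_k^{m-1}`. -/
theorem dunklLaplacian_pow_monomial (h : IsPositiveRoots P k) (d : ℕ) (ν : Fin N →₀ ℕ) (a : ℝ)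
    (hν : ν.degree = d) (m : ℕ) (hm : d < m) :
    (dunklLaplacian P k ^ m) (monomial ν a) = 0 := by
  induction d generalizing ν m with
  | zero =>
    obtain ⟨m, rfl⟩ := Nat.exists_eq_succ_of_ne_zero hm.ne'
    rw [(Finsupp.degree_eq_zero_iff ν).1 hν, pow_succ, Module.End.mul_apply]
    exact (congrArg _ (dunklLaplacian_C h a)).trans (map_zero _)
  | succ d ih =>
    obtain ⟨j, hj⟩ : ∃ j, ν j ≠ 0 := by
      by_contra! hc
      rw [show ν = 0 from Finsupp.ext hc, map_zero] at hν
      omega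
    obtain ⟨μ, rfl⟩ : ∃ μ, ν = Finsupp.single j 1 + μ :=
      ⟨ν - Finsupp.single j 1, (add_tsub_cancel_of_le (by
        rw [Finsupp.single_le_iff]
        omega)).symm⟩
    have hμ : μ.degree = d := by
      rw [map_add, Finsupp.degree_single] at hν
      omega
    obtain ⟨m, rfl⟩ := Nat.exists_eq_succ_of_ne_zero (by omega : m ≠ 0)
    have hX : monomial (Finsupp.single j 1 + μ) a = X j * monomial μ a := by
      rw [X, monomial_mul, one_mul]
    rw [hX, Nat.succ_eq_add_one, dunklLaplacian_pow_X_mul h, ih μ hμ _ (by omega),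
      ih μ hμ _ (by omega)]
    simp

/-- The Dunkl Laplacian is locally nilpotent. -/
theorem dunklLaplacian_pow_eq_zero (h : IsPositiveRoots P k) {p : MvPolynomial (Fin N) ℝ} {m : ℕ}
    (hm : p.totalDegree < m) : (dunklLaplacian P k ^ m) p = 0 := by
  rw [p.as_sum, map_sum]
  refine Finset.sum_eq_zero fun ν hν => dunklLaplacian_pow_monomial h _ ν _ rfl m ?_
  exact lt_of_le_of_lt (le_totalDegree hν) hm

theorem expLaplacian_eq_sum (h : IsPositiveRoots P k) {p : MvPolynomial (Fin N) ℝ} {M : ℕ}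
    (hM : p.totalDegree < M) : expLaplacian P k p = ∑ n ∈ Finset.range M,
      ((-1 / 4 : ℝ) ^ n / (n.factorial : ℝ)) • (dunklLaplacian P k ^ n) p := by
  refine Finset.sum_subset (Finset.range_subset_range.2 hM) fun n _ hn => ?_
  rw [dunklLaplacian_pow_eq_zero h (by simpa using hn), smul_zero]

/-- `e^{-Δ_k/4}` as a linear operator. -/
noncomputable def expLaplacianLin (h : IsPositiveRoots P k) :
    MvPolynomial (Fin N) ℝ →ₗ[ℝ] MvPolynomial (Fin N) ℝ where
  toFun := expLaplacian P k
  map_add' p q := by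
    have hp : p.totalDegree < max p.totalDegree q.totalDegree + 1 := by
      have := le_max_left p.totalDegree q.totalDegree
      omega
    have hq : q.totalDegree < max p.totalDegree q.totalDegree + 1 := by
      have := le_max_right p.totalDegree q.totalDegree
      omega
    have hpq : (p + q).totalDegree < max p.totalDegree q.totalDegree + 1 :=
      Nat.lt_succ_of_le (totalDegree_add p q)
    rw [expLaplacian_eq_sum h hp, expLaplacian_eq_sum h hq, expLaplacian_eq_sum h hpq,
      ← Finset.sum_add_distrib]
    simp only [map_add, smul_add]
  map_smul' a p := by
    rw [expLaplacian_eq_sum h (Nat.lt_succ_of_le (totalDegree_smul_le a p)), expLaplacian,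
      RingHom.id_apply, Finset.smul_sum]
    refine Finset.sum_congr rfl fun n _ => ?_
    rw [map_smul, smul_comm]

theorem expLaplacianLin_apply (h : IsPositiveRoots P k) (p : MvPolynomial (Fin N) ℝ) :
    expLaplacianLin h p = expLaplacian P k p := rfl

theorem expLaplacian_C (a : ℝ) : expLaplacian P k (C a) = C a := by
  simp [expLaplacian]

theorem dunklLaplacian_pow_dunklOp (h : IsPositiveRoots P k) (j : Fin N) (m : ℕ)
    (p : MvPolynomial (Fin N) ℝ) : (dunklLaplacian P k ^ m) (dunklOp P k j p) =
      dunklOp P k j ((dunklLaplacian P k ^ m) p) := by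
  induction m with
  | zero => simp
  | succ m ih =>
    rw [pow_succ', Module.End.mul_apply, ih, dunklLaplacian_dunklOp h, Module.End.mul_apply]

theorem expLaplacian_dunklOp (h : IsPositiveRoots P k) (j : Fin N) (p : MvPolynomial (Fin N) ℝ) :
    expLaplacian P k (dunklOp P k j p) = dunklOp P k j (expLaplacian P k p) := by
  set M := max p.totalDegree (dunklOp P k j p).totalDegree + 1 with hM
  rw [expLaplacian_eq_sum h (M := M) (by omega), expLaplacian_eq_sum h (p := p) (M := M) (by omega),
    map_sum]
  refine Finset.sum_congr rfl fun n _ => ?_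
  rw [map_smul, dunklLaplacian_pow_dunklOp h]

/-- Conjugation by `e^{-Δ_k/4}` turns the multiplication by `x_j` into `x_j - T_j / 2`. -/
theorem expLaplacian_X_mul (h : IsPositiveRoots P k) (j : Fin N) (p : MvPolynomial (Fin N) ℝ) :
    expLaplacian P k (X j * p) = X j * expLaplacian P k p -
      (1 / 2 : ℝ) • dunklOp P k j (expLaplacian P k p) := by
  set M := max p.totalDegree (X j * p).totalDegree + 1 with hM
  rw [expLaplacian_eq_sum h (M := M + 1) (by omega), Finset.sum_range_succ']
  simp only [dunklLaplacian_pow_X_mul h, smul_add, Finset.sum_add_distrib]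
  have h1 : expLaplacian P k p = ∑ n ∈ Finset.range (M + 1),
      ((-1 / 4 : ℝ) ^ n / (n.factorial : ℝ)) • (dunklLaplacian P k ^ n) p :=
    expLaplacian_eq_sum h (by omega)
  have h2 : dunklOp P k j (expLaplacian P k p) = ∑ n ∈ Finset.range M,
      ((-1 / 4 : ℝ) ^ n / (n.factorial : ℝ)) • dunklOp P k j ((dunklLaplacian P k ^ n) p) := by
    rw [expLaplacian_eq_sum h (M := M) (by omega), map_sum]
    simp only [map_smul]
  have h3 : ∑ n ∈ Finset.range M, ((-1 / 4 : ℝ) ^ (n + 1) / ((n + 1).factorial : ℝ)) •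
      (2 * (n + 1) : ℝ) • dunklOp P k j ((dunklLaplacian P k ^ n) p) =
      -((1 / 2 : ℝ) • dunklOp P k j (expLaplacian P k p)) := by
    rw [h2, Finset.smul_sum, ← Finset.sum_neg_distrib]
    refine Finset.sum_congr rfl fun n _ => ?_
    rw [smul_smul, smul_smul, ← neg_smul]
    congr 1
    rw [Nat.factorial_succ]
    push_cast
    field_simp
    ring
  have h4 : X j * expLaplacian P k p = ∑ n ∈ Finset.range M,
      ((-1 / 4 : ℝ) ^ (n + 1) / ((n + 1).factorial : ℝ)) •
        (X j * (dunklLaplacian P k ^ (n + 1)) p) + X j * p := by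
    rw [h1, Finset.sum_range_succ', mul_add, Finset.mul_sum]
    simp
  rw [h3, h4]
  simp
  ring

/-- The range of `e^{-Δ_k/4}` is closed under multiplication by `x_j`, as
`x_j e^{-Δ_k/4} a = e^{-Δ_k/4} (x_j a + T_j a / 2)`. -/
theorem expLaplacian_surjective (h : IsPositiveRoots P k) :
    Function.Surjective (expLaplacian P k) := by
  intro p
  induction p using MvPolynomial.induction_on with
  | C a => exact ⟨C a, expLaplacian_C a⟩
  | add p q hp hq =>
    obtain ⟨a, rfl⟩ := hp
    obtain ⟨b, rfl⟩ := hq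
    exact ⟨a + b, (expLaplacianLin h).map_add a b⟩
  | mul_X p j hp =>
    obtain ⟨a, rfl⟩ := hp
    refine ⟨X j * a + (1 / 2 : ℝ) • dunklOp P k j a, ?_⟩
    have := (expLaplacianLin h).map_add (X j * a) ((1 / 2 : ℝ) • dunklOp P k j a)
    rw [map_smul] at this
    simp only [expLaplacianLin_apply] at this
    rw [this, expLaplacian_X_mul h, expLaplacian_dunklOp h]
    ring

/-! ### The pairing and adjoint pairs of operators -/

/-- If the multiplications by the polynomials `f i` have the adjoints `c i • F i` with respect to
a bilinear form `B`, then the product of the `f i` corresponds in the same way to the product of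
the `F i` in the same order: multiplications commute, so no reversal occurs. -/
theorem adjoint_list_prod (B : MvPolynomial (Fin N) ℝ → MvPolynomial (Fin N) ℝ → ℝ) {n : ℕ}
    (f : Fin n → MvPolynomial (Fin N) ℝ) (F : Fin n → Module.End ℝ (MvPolynomial (Fin N) ℝ))
    (c : Fin n → ℝ) (hB : ∀ i p q, B (f i * p) q = c i * B p (F i q))
    (p q : MvPolynomial (Fin N) ℝ) :
    B ((∏ i, f i) * p) q = (∏ i, c i) * B p ((List.ofFn F).prod q) := by
  induction n generalizing p q with
  | zero => simp
  | succ n ih =>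
    rw [List.ofFn_succ, List.prod_cons, Fin.prod_univ_succ, Fin.prod_univ_succ, mul_comm (f 0),
      mul_assoc, ih _ _ (fun i => c i.succ) (fun i => hB i.succ), hB, Module.End.mul_apply]
    ring

theorem adjoint_pow (B : MvPolynomial (Fin N) ℝ → MvPolynomial (Fin N) ℝ → ℝ)
    {f : MvPolynomial (Fin N) ℝ} {F : Module.End ℝ (MvPolynomial (Fin N) ℝ)}
    {c : ℝ} (hB : ∀ p q, B (f * p) q = c * B p (F q)) (n : ℕ)
    (p q : MvPolynomial (Fin N) ℝ) : B (f ^ n * p) q = c ^ n * B p ((F ^ n) q) := by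
  induction n generalizing p q with
  | zero => simp
  | succ n ih =>
    rw [pow_succ, mul_assoc, ih, hB, pow_succ', pow_succ' F, Module.End.mul_apply]
    ring

/-- A bilinear form for which the multiplication by `x_i` has the adjoint `T_i / 2` and which
agrees with the evaluation at the origin if the first entry is `1` is the pairing `[·,·]_k`, up to
a power of two. -/
theorem pairing_eq_of_adjoint
    (B : MvPolynomial (Fin N) ℝ →ₗ[ℝ] MvPolynomial (Fin N) ℝ →ₗ[ℝ] ℝ)
    (hB : ∀ i p q, B (X i * p) q = 1 / 2 * B p (dunklOp P k i q)) (hB1 : ∀ q, B 1 q = eval 0 q)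
    {p : MvPolynomial (Fin N) ℝ} {d : ℕ} (hp : p.IsHomogeneous d) (q : MvPolynomial (Fin N) ℝ) :
    B p q = (1 / 2) ^ d * pairing P k p q := by
  have hmon : ∀ ν : Fin N →₀ ℕ, B (monomial ν 1) q =
      (1 / 2) ^ ν.degree * eval 0 ((List.ofFn fun i => dunklOp P k i ^ ν i).prod q) := fun ν => by
    have := adjoint_list_prod (fun p q => B p q) (fun i => X i ^ ν i)
      (fun i => dunklOp P k i ^ ν i) (fun i => (1 / 2 : ℝ) ^ ν i)
      (fun i p q => adjoint_pow (fun p q => B p q) (hB i) (ν i) p q) 1 q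
    rw [mul_one, hB1, Finset.prod_pow_eq_pow_sum] at this
    rw [Finsupp.degree_eq_sum, ← this, monomial_eq, C_1, one_mul, Finsupp.prod_fintype]
    simp
  conv_lhs => rw [p.as_sum]
  rw [pairing, polyDunkl, map_sum, LinearMap.sum_apply, LinearMap.sum_apply, map_sum,
    Finset.mul_sum]
  refine Finset.sum_congr rfl fun ν hν => ?_
  have hd : ν.degree = d := by
    have := hp (mem_support_iff.1 hν)
    rwa [Finsupp.degree_eq_weight_one]
  have hm : monomial ν (p.coeff ν) = p.coeff ν • monomial ν (1 : ℝ) := by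
    rw [smul_monomial, smul_eq_mul, mul_one]
  rw [hm, map_smul, LinearMap.smul_apply, hmon, hd, LinearMap.smul_apply, smul_eval, smul_eq_mul]
  ring

/-! ### Functions of polynomial growth and Gaussian integrability -/

/-- The function `g` grows at most polynomially. -/
def HasPolyGrowth (g : Space N → ℝ) : Prop :=
  ∃ C : ℝ, ∃ n : ℕ, 0 ≤ C ∧ ∀ x, |g x| ≤ C * (1 + ‖x‖) ^ n

theorem HasPolyGrowth.mul {f g : Space N → ℝ} (hf : HasPolyGrowth f) (hg : HasPolyGrowth g) :
    HasPolyGrowth fun x => f x * g x := by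
  obtain ⟨C, n, hC, hf⟩ := hf
  obtain ⟨D, m, hD, hg⟩ := hg
  refine ⟨C * D, n + m, by positivity, fun x => ?_⟩
  rw [abs_mul, pow_add, mul_mul_mul_comm]
  exact mul_le_mul (hf x) (hg x) (abs_nonneg _) (by positivity)

theorem HasPolyGrowth.mono {f g : Space N → ℝ} (hg : HasPolyGrowth g) (h : ∀ x, |f x| ≤ |g x|) :
    HasPolyGrowth f := by
  obtain ⟨C, n, hC, hg⟩ := hg
  exact ⟨C, n, hC, fun x => (h x).trans (hg x)⟩

theorem hasPolyGrowth_eval (p : MvPolynomial (Fin N) ℝ) :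
    HasPolyGrowth fun x => eval (fun i => x i) p :=
  eval_bound p

theorem integrable_mul_exp_mul_gaussian {g : Space N → ℝ} (hg : HasPolyGrowth g)
    (hm : AEStronglyMeasurable g volume) (a : ℝ) :
    Integrable fun x : Space N => g x * (Real.exp (a * ‖x‖) * Real.exp (-‖x‖ ^ 2)) := by
  obtain ⟨C, n, hC, hg⟩ := hg
  set M := n + (N + 1) with hM
  set K : ℝ := M.factorial * Real.exp (1 + (a + 1) ^ 2 / 4) with hK
  have hint := (integrable_one_add_norm (E := Space N) (μ := volume)
    (r := ((N + 1 : ℕ) : ℝ)) (by simp)).const_mul (C * K)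
  refine hint.mono' (hm.mul (by fun_prop)) (Eventually.of_forall fun x => ?_)
  have hpos : 0 < (1 + ‖x‖) ^ (N + 1) := by positivity
  have hkey : (1 + ‖x‖) ^ M * (Real.exp (a * ‖x‖) * Real.exp (-‖x‖ ^ 2)) ≤ K := by
    have h1 : (1 + ‖x‖) ^ M ≤ M.factorial * Real.exp (1 + ‖x‖) := by
      have := Real.pow_div_factorial_le_exp (1 + ‖x‖) (by positivity) M
      rwa [div_le_iff₀ (by positivity), mul_comm] at this
    calc _ ≤ M.factorial * Real.exp (1 + ‖x‖) * (Real.exp (a * ‖x‖) * Real.exp (-‖x‖ ^ 2)) := by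
          gcongr
      _ = M.factorial * Real.exp (1 + ‖x‖ + (a * ‖x‖ + -‖x‖ ^ 2)) := by
          rw [Real.exp_add (1 + ‖x‖), Real.exp_add (a * ‖x‖)]
          ring
      _ ≤ K := by
          refine mul_le_mul_of_nonneg_left (Real.exp_le_exp.2 ?_) (by positivity)
          nlinarith [sq_nonneg (‖x‖ - (a + 1) / 2)]
  rw [Real.rpow_neg (by positivity), Real.rpow_natCast, ← div_eq_mul_inv, le_div_iff₀ hpos,
    Real.norm_eq_abs, abs_mul, abs_mul, Real.abs_exp, Real.abs_exp]
  calc |g x| * (Real.exp (a * ‖x‖) * Real.exp (-‖x‖ ^ 2)) * (1 + ‖x‖) ^ (N + 1)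
      ≤ C * (1 + ‖x‖) ^ n * (Real.exp (a * ‖x‖) * Real.exp (-‖x‖ ^ 2)) *
        (1 + ‖x‖) ^ (N + 1) := by
        gcongr
        exact hg x
    _ = C * ((1 + ‖x‖) ^ M * (Real.exp (a * ‖x‖) * Real.exp (-‖x‖ ^ 2))) := by
        rw [hM, pow_add]
        ring
    _ ≤ _ := mul_le_mul_of_nonneg_left hkey hC

theorem integrable_mul_gaussian {g : Space N → ℝ} (hg : HasPolyGrowth g)
    (hm : AEStronglyMeasurable g volume) :
    Integrable fun x : Space N => g x * Real.exp (-‖x‖ ^ 2) := by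
  simpa using integrable_mul_exp_mul_gaussian hg hm 0

theorem continuous_eval_space (p : MvPolynomial (Fin N) ℝ) :
    Continuous fun x : Space N => eval (fun i => x i) p :=
  (MvPolynomial.continuous_eval p).comp (by fun_prop)

/-! ### The regularized weight -/

/-- The approximation `∏_{η ∈ R₊} (⟨η, x⟩² + ε)^{k(η)}` of the weight. It is smooth for `ε > 0`,
and it is the weight itself for `ε = 0`, see `regWeight_zero`. -/
noncomputable def regWeight (P : Finset (Space N)) (k : Space N → ℝ≥0) (ε : ℝ) (x : Space N) : ℝ :=
  ∏ η ∈ P, (inner ℝ η x ^ 2 + ε) ^ (k η : ℝ)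

theorem regWeight_zero (x : Space N) : regWeight P k 0 x = weight P k x := by
  refine Finset.prod_congr rfl fun η _ => ?_
  rw [add_zero, Real.rpow_mul (abs_nonneg _), Real.rpow_two, sq_abs]

theorem regWeight_nonneg {ε : ℝ} (hε : 0 ≤ ε) (x : Space N) : 0 ≤ regWeight P k ε x :=
  Finset.prod_nonneg fun _ _ => by positivity

theorem regWeight_le {ε : ℝ} (hε : 0 ≤ ε) (hε1 : ε ≤ 1) (x : Space N) :
    regWeight P k ε x ≤ regWeight P k 1 x := by
  refine Finset.prod_le_prod (fun _ _ => by positivity) fun η _ => ?_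
  gcongr

theorem continuous_regWeight (ε : ℝ) : Continuous (regWeight P k ε) := by
  refine continuous_finsetProd _ fun η _ => ?_
  exact Continuous.rpow_const (by fun_prop) fun x => Or.inr (k η).2

theorem continuous_regWeight_left (x : Space N) : Continuous fun ε => regWeight P k ε x := by
  refine continuous_finsetProd _ fun η _ => ?_
  exact Continuous.rpow_const (by fun_prop) fun x => Or.inr (k η).2

theorem regWeight_refl (h : IsPositiveRoots P k) {u : Space N} (hu : u ∈ P) (ε : ℝ) (x : Space N) :
    regWeight P k ε (refl u x) = regWeight P k ε x := by
  rw [regWeight, regWeight,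
    ← h.prod_refl hu fun c η => (inner ℝ η x ^ 2 + ε) ^ (c : ℝ)]
  · refine Finset.prod_congr rfl fun η _ => ?_
    rw [← (refl u).inner_map_map (refl u η), refl_refl]
  · intro c y
    rw [inner_neg_left, neg_sq]

theorem hasPolyGrowth_regWeight_one : HasPolyGrowth (regWeight P k 1) := by
  classical
  induction P using Finset.induction_on with
  | empty => exact ⟨1, 0, zero_le_one, fun x => by simp [regWeight]⟩
  | insert η P hη ih =>
    have hw : regWeight (insert η P) k 1 =
        fun x => (inner ℝ η x ^ 2 + 1) ^ (k η : ℝ) * regWeight P k 1 x := by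
      funext x
      simp [regWeight, Finset.prod_insert hη]
    rw [hw]
    refine HasPolyGrowth.mul ?_ ih
    have h1 : HasPolyGrowth fun x : Space N => (inner ℝ η x ^ 2 + 1) ^ ⌈(k η : ℝ)⌉₊ := by
      have := hasPolyGrowth_eval ((linForm η ^ 2 + 1) ^ ⌈(k η : ℝ)⌉₊)
      simpa [eval_linForm] using this
    refine h1.mono fun x => ?_
    rw [abs_of_nonneg (by positivity), abs_of_nonneg (by positivity),
      ← Real.rpow_natCast _ ⌈(k η : ℝ)⌉₊]
    exact Real.rpow_le_rpow_of_exponent_le (le_add_of_nonneg_left (sq_nonneg _))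
      (Nat.le_ceil _)

theorem hasPolyGrowth_regWeight {ε : ℝ} (hε : 0 ≤ ε) (hε1 : ε ≤ 1) :
    HasPolyGrowth (regWeight P k ε) :=
  hasPolyGrowth_regWeight_one.mono fun x => by
    rw [abs_of_nonneg (regWeight_nonneg hε x), abs_of_nonneg (regWeight_nonneg zero_le_one x)]
    exact regWeight_le hε hε1 x

/-! ### Line derivatives -/

theorem hasLineDerivAt_mul {f g : Space N → ℝ} {f' g' : ℝ} {x v : Space N}
    (hf : HasLineDerivAt ℝ f f' x v) (hg : HasLineDerivAt ℝ g g' x v) :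
    HasLineDerivAt ℝ (fun y => f y * g y) (f' * g x + f x * g') x v := by
  have := HasDerivAt.fun_mul hf hg
  simpa [HasLineDerivAt] using this

theorem hasLineDerivAt_eval (i : Fin N) (p : MvPolynomial (Fin N) ℝ) (x : Space N) :
    HasLineDerivAt ℝ (fun y : Space N => eval (fun i => y i) p)
      (eval (fun i => x i) (pderiv i p)) x (EuclideanSpace.single i 1) := by
  induction p using MvPolynomial.induction_on with
  | C a => simpa [HasLineDerivAt] using hasDerivAt_const (0 : ℝ) a
  | add p q hp hq =>
    have := HasDerivAt.fun_add hp hq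
    simpa [HasLineDerivAt] using this
  | mul_X p j hp =>
    have hX : HasLineDerivAt ℝ (fun y : Space N => y j)
        (if j = i then 1 else 0) x (EuclideanSpace.single i 1) := by
      have h1 : HasDerivAt (fun t : ℝ => x j + t * (if j = i then 1 else 0))
          (if j = i then 1 else 0) 0 := by
        simpa using ((hasDerivAt_id (0 : ℝ)).mul_const (if j = i then (1 : ℝ) else 0)).const_add
          (x j)
      simpa [HasLineDerivAt, Pi.single_apply] using h1
    have := hasLineDerivAt_mul hp hX
    have hD : eval (fun i => x i) (pderiv i (p * X j)) =
        eval (fun i => x i) (pderiv i p) * x j +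
          eval (fun i => x i) p * (if j = i then 1 else 0) := by
      rw [pderiv_mul, pderiv_X, map_add, map_mul, map_mul, eval_X]
      by_cases hij : j = i
      · simp [hij]
      · simp [hij]
    rw [hD]
    simpa using this

theorem hasLineDerivAt_gaussian (i : Fin N) (x : Space N) :
    HasLineDerivAt ℝ (fun y : Space N => Real.exp (-‖y‖ ^ 2))
      (-2 * x i * Real.exp (-‖x‖ ^ 2)) x (EuclideanSpace.single i 1) := by
  have h1 : HasDerivAt (fun t : ℝ => x + t • (EuclideanSpace.single i 1 : Space N))
      (EuclideanSpace.single i 1) 0 := by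
    simpa using ((hasDerivAt_id (0 : ℝ)).smul_const
      (EuclideanSpace.single i 1 : Space N)).const_add x
  have h2 := (h1.norm_sq.neg).exp
  have h3 : inner ℝ x (EuclideanSpace.single i 1 : Space N) = x i := by
    simp [EuclideanSpace.inner_single_right]
  refine HasDerivAt.congr_deriv h2 ?_
  simp [h3]
  ring

theorem hasLineDerivAt_regWeight {ε : ℝ} (hε : 0 < ε) (i : Fin N) (x : Space N) :
    HasLineDerivAt ℝ (regWeight P k ε)
      ((∑ η ∈ P, 2 * (k η : ℝ) * η i * (inner ℝ η x / (inner ℝ η x ^ 2 + ε))) *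
        regWeight P k ε x) x (EuclideanSpace.single i 1) := by
  classical
  induction P using Finset.induction_on with
  | empty => simpa [HasLineDerivAt, regWeight] using hasDerivAt_const (0 : ℝ) (1 : ℝ)
  | insert η P hη ih =>
    have hw : regWeight (insert η P) k ε =
        fun x => (inner ℝ η x ^ 2 + ε) ^ (k η : ℝ) * regWeight P k ε x := by
      funext x
      simp [regWeight, Finset.prod_insert hη]
    have hpos : (0 : ℝ) < inner ℝ η x ^ 2 + ε := by positivity
    have h1 : HasLineDerivAt ℝ (fun y => (inner ℝ η y ^ 2 + ε) ^ (k η : ℝ))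
        (2 * (k η : ℝ) * η i * (inner ℝ η x / (inner ℝ η x ^ 2 + ε)) *
          (inner ℝ η x ^ 2 + ε) ^ (k η : ℝ)) x (EuclideanSpace.single i 1) := by
      have h3 : inner ℝ η (EuclideanSpace.single i 1 : Space N) = η i := by
        simp [EuclideanSpace.inner_single_right]
      have h2 : HasDerivAt (fun t : ℝ => inner ℝ η x + t * η i) (η i) 0 := by
        simpa using ((hasDerivAt_id (0 : ℝ)).mul_const (η i)).const_add (inner ℝ η x)
      have h4 := ((h2.fun_pow 2).add_const ε).rpow_const (p := (k η : ℝ))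
        (Or.inl (by simpa using hpos.ne'))
      rw [HasLineDerivAt]
      simp only [inner_add_right, inner_smul_right, h3]
      refine HasDerivAt.congr_deriv h4 ?_
      simp only [zero_mul, add_zero, Nat.add_one_sub_one, pow_one, Nat.cast_ofNat]
      rw [Real.rpow_sub_one hpos.ne']
      ring
    rw [hw, Finset.sum_insert hη]
    convert hasLineDerivAt_mul h1 ih using 1
    ring

/-! ### Gaussian integrals and Dunkl operators -/

theorem integrable_regWeight {ε : ℝ} (hε : 0 ≤ ε) (hε1 : ε ≤ 1) {g : Space N → ℝ}
    (hg : HasPolyGrowth g) (hc : AEStronglyMeasurable g volume) :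
    Integrable fun x => g x * (Real.exp (-‖x‖ ^ 2) * regWeight P k ε x) := by
  have := integrable_mul_gaussian (hg.mul (hasPolyGrowth_regWeight (P := P) (k := k) hε hε1))
    (hc.mul (continuous_regWeight ε).aestronglyMeasurable)
  refine this.congr (Eventually.of_forall fun x => ?_)
  simp only
  ring

/-- Reflections preserve the Gaussian measure with the regularized weight. -/
theorem integral_refl (h : IsPositiveRoots P k) {u : Space N} (hu : u ∈ P) (ε : ℝ)
    (g : Space N → ℝ) :
    ∫ x, g (refl u x) * (Real.exp (-‖x‖ ^ 2) * regWeight P k ε x) =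
      ∫ x, g x * (Real.exp (-‖x‖ ^ 2) * regWeight P k ε x) := by
  rw [← (refl u).measurePreserving.integral_comp (refl u).toHomeomorph.measurableEmbedding
    fun x => g x * (Real.exp (-‖x‖ ^ 2) * regWeight P k ε x)]
  refine integral_congr_ae (Eventually.of_forall fun x => ?_)
  simp only [regWeight_refl h hu, (refl u).norm_map]

theorem hasPolyGrowth_quotient (η : Space N) {ε : ℝ} (hε : 0 < ε) :
    HasPolyGrowth fun x : Space N => inner ℝ η x / (inner ℝ η x ^ 2 + ε) := by
  refine (hasPolyGrowth_eval (C ε⁻¹ * linForm η)).mono fun x => ?_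
  rw [map_mul, eval_C, eval_linForm, abs_div, abs_mul, abs_inv, inv_mul_eq_div]
  gcongr
  exact le_add_of_nonneg_left (sq_nonneg _)

theorem continuous_quotient (η : Space N) {ε : ℝ} (hε : 0 < ε) :
    Continuous fun x : Space N => (inner ℝ η x : ℝ) / (inner ℝ η x ^ 2 + ε) :=
  Continuous.div (by fun_prop) (by fun_prop) fun x => by positivity

/-- Since `⟨η, x⟩ / (⟨η, x⟩² + ε)` is odd under `σ_η`, integration against it only sees the
divided difference. -/
theorem integral_mul_quotient (h : IsPositiveRoots P k) {η : Space N} (hη : η ∈ P) {ε : ℝ}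
    (hε : 0 < ε) (hε1 : ε ≤ 1) (p : MvPolynomial (Fin N) ℝ) :
    2 * ∫ x : Space N, eval (fun i => x i) p * (inner ℝ η x / (inner ℝ η x ^ 2 + ε)) *
        (Real.exp (-‖x‖ ^ 2) * regWeight P k ε x) =
      ∫ x : Space N, eval (fun i => x i) (divDiff η p) *
        (inner ℝ η x ^ 2 / (inner ℝ η x ^ 2 + ε)) *
        (Real.exp (-‖x‖ ^ 2) * regWeight P k ε x) := by
  have hη2 := h.inner_self η hη
  have hint : ∀ q : MvPolynomial (Fin N) ℝ, Integrable fun x : Space N =>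
      eval (fun i => x i) q * (inner ℝ η x / (inner ℝ η x ^ 2 + ε)) *
        (Real.exp (-‖x‖ ^ 2) * regWeight P k ε x) := fun q =>
    integrable_regWeight hε.le hε1 ((hasPolyGrowth_eval q).mul (hasPolyGrowth_quotient η hε))
      ((continuous_eval_space q).mul (continuous_quotient η hε)).aestronglyMeasurable
  have h1 := integral_refl h hη ε
    fun x => eval (fun i => x i) p * (inner ℝ η x / (inner ℝ η x ^ 2 + ε))
  have h2 : ∀ x : Space N, inner ℝ η (refl η x) = -(inner ℝ η x : ℝ) := fun x => by
    rw [refl_apply hη2, inner_sub_right, inner_smul_right, hη2]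
    ring
  -- In one of two copies of the integral, change variables by `σ_η`.
  rw [two_mul]
  nth_rewrite 2 [← h1]
  have h3 : ∀ x : Space N, eval (fun i => refl η x i) p *
      (inner ℝ η (refl η x) / (inner ℝ η (refl η x) ^ 2 + ε)) *
        (Real.exp (-‖x‖ ^ 2) * regWeight P k ε x) =
      -(eval (fun i => x i) (reflPoly η p) * (inner ℝ η x / (inner ℝ η x ^ 2 + ε)) *
        (Real.exp (-‖x‖ ^ 2) * regWeight P k ε x)) := fun x => by
    rw [eval_reflPoly hη2, h2]
    ring
  simp only [h3]
  rw [integral_neg, ← sub_eq_add_neg, ← integral_sub (hint p) (hint _)]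
  refine integral_congr_ae (Eventually.of_forall fun x => ?_)
  have h4 := congrArg (eval fun i => x i) (linForm_mul_divDiff η p)
  rw [map_mul, eval_linForm, map_sub] at h4
  simp only
  rw [← sub_mul, ← sub_mul, ← h4]
  ring

/-- Integration by parts for the regularized weight. -/
theorem integral_pderiv_regWeight (h : IsPositiveRoots P k) {ε : ℝ} (hε : 0 < ε) (hε1 : ε ≤ 1)
    (i : Fin N) (p : MvPolynomial (Fin N) ℝ) :
    (∫ x : Space N, eval (fun i => x i) (pderiv i p - C 2 * (X i * p)) *
        (Real.exp (-‖x‖ ^ 2) * regWeight P k ε x)) +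
      ∑ η ∈ P, (k η : ℝ) * η i * ∫ x : Space N, eval (fun i => x i) (divDiff η p) *
        (inner ℝ η x ^ 2 / (inner ℝ η x ^ 2 + ε)) *
        (Real.exp (-‖x‖ ^ 2) * regWeight P k ε x) = 0 := by
  have hint1 : ∀ q : MvPolynomial (Fin N) ℝ, Integrable fun x : Space N =>
      eval (fun i => x i) q * (Real.exp (-‖x‖ ^ 2) * regWeight P k ε x) := fun q =>
    integrable_regWeight hε.le hε1 (hasPolyGrowth_eval q)
      (continuous_eval_space q).aestronglyMeasurable
  have hint2 : ∀ η, Integrable fun x : Space N =>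
      eval (fun i => x i) p * (inner ℝ η x / (inner ℝ η x ^ 2 + ε)) *
        (Real.exp (-‖x‖ ^ 2) * regWeight P k ε x) := fun η =>
    integrable_regWeight hε.le hε1 ((hasPolyGrowth_eval p).mul (hasPolyGrowth_quotient η hε))
      ((continuous_eval_space p).mul (continuous_quotient η hε)).aestronglyMeasurable
  have hder : ∀ x : Space N, HasLineDerivAt ℝ (fun x : Space N => eval (fun i => x i) p *
      (Real.exp (-‖x‖ ^ 2) * regWeight P k ε x))
      (eval (fun i => x i) (pderiv i p - C 2 * (X i * p)) *
        (Real.exp (-‖x‖ ^ 2) * regWeight P k ε x) +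
        ∑ η ∈ P, (2 * (k η : ℝ) * η i) * (eval (fun i => x i) p *
          (inner ℝ η x / (inner ℝ η x ^ 2 + ε)) * (Real.exp (-‖x‖ ^ 2) * regWeight P k ε x)))
      x (EuclideanSpace.single i 1) := fun x => by
    convert hasLineDerivAt_mul (hasLineDerivAt_eval i p x) (hasLineDerivAt_mul
      (hasLineDerivAt_gaussian i x) (hasLineDerivAt_regWeight (P := P) (k := k) hε i x)) using 1
    have : ∑ η ∈ P, (2 * (k η : ℝ) * η i) * (eval (fun i => x i) p *
          (inner ℝ η x / (inner ℝ η x ^ 2 + ε)) * (Real.exp (-‖x‖ ^ 2) * regWeight P k ε x)) =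
        eval (fun i => x i) p * (Real.exp (-‖x‖ ^ 2) *
          ((∑ η ∈ P, 2 * (k η : ℝ) * η i * (inner ℝ η x / (inner ℝ η x ^ 2 + ε))) *
            regWeight P k ε x)) := by
      rw [Finset.sum_mul, Finset.mul_sum, Finset.mul_sum]
      exact Finset.sum_congr rfl fun η _ => by ring
    rw [this]
    simp only [map_sub, map_mul, eval_C, eval_X]
    ring
  have hD := (hint1 (pderiv i p - C 2 * (X i * p))).add
    (integrable_finsetSum P fun η _ => (hint2 η).const_mul (2 * (k η : ℝ) * η i))
  -- The integral of a derivative is zero: integrate by parts against the constant `1`.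
  have hz := integral_bilinear_hasLineDerivAt_right_eq_neg_left_of_integrable (μ := volume)
    (B := ContinuousLinearMap.mul ℝ ℝ) (f := fun _ : Space N => (1 : ℝ)) (f' := fun _ => 0)
    (g := fun x : Space N => eval (fun i => x i) p *
      (Real.exp (-‖x‖ ^ 2) * regWeight P k ε x)) (v := EuclideanSpace.single i 1)
    (by simp) (hD.congr (Eventually.of_forall fun x => by simp)) (by simpa using hint1 p)
    (fun x _ => by simpa [HasLineDerivAt] using hasDerivAt_const (0 : ℝ) (1 : ℝ))
    (fun x _ => hder x)
  simp only [ContinuousLinearMap.mul_apply', one_mul, zero_mul, integral_zero, neg_zero] at hz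
  rw [integral_add (hint1 _) (integrable_finsetSum P fun η _ =>
    (hint2 η).const_mul (2 * (k η : ℝ) * η i)), integral_finsetSum _ fun η _ =>
    (hint2 η).const_mul (2 * (k η : ℝ) * η i)] at hz
  rw [← hz]
  congr 1
  refine Finset.sum_congr rfl fun η hη => ?_
  rw [← integral_mul_quotient h hη hε hε1, integral_const_mul]
  ring

theorem ae_inner_ne_zero {η : Space N} (hη : η ≠ 0) : ∀ᵐ x : Space N, (inner ℝ η x : ℝ) ≠ 0 := by
  have h0 : volume (((ℝ ∙ η)ᗮ : Submodule ℝ (Space N)) : Set (Space N)) = 0 := by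
    refine Measure.addHaar_submodule _ _ fun htop => hη ?_
    have : η ∈ (ℝ ∙ η)ᗮ := htop ▸ Submodule.mem_top
    rwa [Submodule.mem_orthogonal_singleton_iff_inner_right, inner_self_eq_zero] at this
  rw [ae_iff]
  convert h0 using 2
  ext x
  simp [Submodule.mem_orthogonal_singleton_iff_inner_right]

/-- The Gaussian integral `∫ p(x) e^{-|x|²} ω_k(x) dx` as a linear functional on polynomials. The
weight is written as `regWeight P k 0`, the limit of the regularized weights. -/
noncomputable def gaussInt (P : Finset (Space N)) (k : Space N → ℝ≥0) :
    MvPolynomial (Fin N) ℝ →ₗ[ℝ] ℝ where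
  toFun p := ∫ x : Space N, eval (fun i => x i) p * (Real.exp (-‖x‖ ^ 2) * regWeight P k 0 x)
  map_add' p q := by
    have hint : ∀ q : MvPolynomial (Fin N) ℝ, Integrable fun x : Space N =>
      eval (fun i => x i) q * (Real.exp (-‖x‖ ^ 2) * regWeight P k 0 x) := fun q =>
      integrable_regWeight le_rfl zero_le_one (hasPolyGrowth_eval q)
        (continuous_eval_space q).aestronglyMeasurable
    simp only [map_add, add_mul]
    exact integral_add (hint p) (hint q)
  map_smul' c p := by
    simp only [smul_eval, mul_assoc, RingHom.id_apply, smul_eq_mul]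
    exact integral_const_mul _ _

theorem gaussInt_apply (p : MvPolynomial (Fin N) ℝ) : gaussInt P k p =
    ∫ x : Space N, eval (fun i => x i) p * (Real.exp (-‖x‖ ^ 2) * regWeight P k 0 x) := rfl

theorem gaussInt_reflPoly (h : IsPositiveRoots P k) {u : Space N} (hu : u ∈ P)
    (p : MvPolynomial (Fin N) ℝ) : gaussInt P k (reflPoly u p) = gaussInt P k p := by
  simp only [gaussInt_apply, eval_reflPoly (h.inner_self u hu)]
  exact integral_refl h hu 0 fun x => eval (fun i => x i) p

/-- Let `ε → 0` in the integration by parts for the regularized weight. -/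
theorem gaussInt_dunklOp (h : IsPositiveRoots P k) (i : Fin N) (p : MvPolynomial (Fin N) ℝ) :
    gaussInt P k (dunklOp P k i p) = 2 * gaussInt P k (X i * p) := by
  -- Dominated convergence; the dominating function is the one for `ε = 1`.
  have hlim : ∀ (q : MvPolynomial (Fin N) ℝ) (r : ℝ → Space N → ℝ),
      (∀ ε, 0 < ε → Continuous (r ε)) → (∀ ε, 0 < ε → ∀ x, |r ε x| ≤ 1) →
      (∀ᵐ x : Space N, Tendsto (fun ε => r ε x) (𝓝[>] 0) (𝓝 1)) →
      Tendsto (fun ε => ∫ x : Space N, eval (fun i => x i) q * r ε x *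
        (Real.exp (-‖x‖ ^ 2) * regWeight P k ε x)) (𝓝[>] 0) (𝓝 (gaussInt P k q)) := by
    intro q r hrc hr hr1
    have hev : ∀ᶠ ε : ℝ in 𝓝[>] 0, 0 < ε ∧ ε ≤ 1 := Ioc_mem_nhdsGT zero_lt_one
    refine tendsto_integral_filter_of_dominated_convergence (fun x : Space N =>
      |eval (fun i => x i) q| * (Real.exp (-‖x‖ ^ 2) * regWeight P k 1 x)) ?_ ?_ ?_ ?_
    · filter_upwards [hev] with ε hε
      have h1 := hrc ε hε.1
      have h2 := continuous_regWeight (P := P) (k := k) ε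
      have h3 := continuous_eval_space q
      exact Continuous.aestronglyMeasurable (by fun_prop)
    · filter_upwards [hev] with ε hε
      refine Eventually.of_forall fun x => ?_
      rw [Real.norm_eq_abs, abs_mul, abs_mul, abs_mul, Real.abs_exp,
        abs_of_nonneg (regWeight_nonneg hε.1.le x)]
      have h1 := hr ε hε.1 x
      have h2 := regWeight_le (P := P) (k := k) hε.1.le hε.2 x
      have h3 := regWeight_nonneg (P := P) (k := k) hε.1.le x
      calc _ ≤ |eval (fun i => x i) q| * 1 * (Real.exp (-‖x‖ ^ 2) * regWeight P k 1 x) := by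
            gcongr
        _ = _ := by rw [mul_one]
    · exact integrable_regWeight zero_le_one le_rfl
        ((hasPolyGrowth_eval q).mono fun x => (abs_abs _).le)
        (continuous_eval_space q).abs.aestronglyMeasurable
    · filter_upwards [hr1] with x hx
      have h1 : Tendsto (fun ε => regWeight P k ε x) (𝓝[>] 0) (𝓝 (regWeight P k 0 x)) :=
        ((continuous_regWeight_left x).tendsto 0).mono_left nhdsWithin_le_nhds
      have h2 := (hx.const_mul (eval (fun i => x i) q)).mul
        (h1.const_mul (Real.exp (-‖x‖ ^ 2)))
      rwa [mul_one] at h2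
  have h1 := hlim (pderiv i p - C 2 * (X i * p)) (fun _ _ => 1) (fun _ _ => continuous_const)
    (fun _ _ _ => by simp) (Eventually.of_forall fun _ => tendsto_const_nhds)
  have h2 : ∀ η ∈ P, Tendsto (fun ε => ∫ x : Space N, eval (fun i => x i) (divDiff η p) *
        (inner ℝ η x ^ 2 / (inner ℝ η x ^ 2 + ε)) *
        (Real.exp (-‖x‖ ^ 2) * regWeight P k ε x)) (𝓝[>] 0)
        (𝓝 (gaussInt P k (divDiff η p))) := fun η hη => by
    refine hlim _ (fun ε x => inner ℝ η x ^ 2 / (inner ℝ η x ^ 2 + ε)) (fun ε hε => ?_)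
      (fun ε hε x => ?_) ?_
    · exact Continuous.div (by fun_prop) (by fun_prop) fun x => by positivity
    · rw [abs_of_nonneg (by positivity)]
      exact div_le_one_of_le₀ (by linarith) (by positivity)
    · filter_upwards [ae_inner_ne_zero (h.ne_zero hη)] with x hx
      have h3 : ContinuousAt (fun ε : ℝ => (inner ℝ η x : ℝ) ^ 2 / (inner ℝ η x ^ 2 + ε)) 0 :=
        ContinuousAt.div (by fun_prop) (by fun_prop) (by simpa using hx)
      have h4 := h3.tendsto.mono_left (nhdsWithin_le_nhds (s := Set.Ioi 0))
      have h5 : (inner ℝ η x : ℝ) ^ 2 ≠ 0 := pow_ne_zero 2 hx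
      simpa [h5] using h4
  have h3 := h1.add (tendsto_finsetSum P fun η hη => (h2 η hη).const_mul ((k η : ℝ) * η i))
  have h4 : (fun ε => (∫ x : Space N, eval (fun i => x i) (pderiv i p - C 2 * (X i * p)) * 1 *
        (Real.exp (-‖x‖ ^ 2) * regWeight P k ε x)) +
      ∑ η ∈ P, (k η : ℝ) * η i * ∫ x : Space N, eval (fun i => x i) (divDiff η p) *
        (inner ℝ η x ^ 2 / (inner ℝ η x ^ 2 + ε)) *
        (Real.exp (-‖x‖ ^ 2) * regWeight P k ε x)) =ᶠ[𝓝[>] 0] fun _ => (0 : ℝ) := by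
    filter_upwards [Ioc_mem_nhdsGT (zero_lt_one (α := ℝ))] with ε hε
    simp only [mul_one]
    exact integral_pderiv_regWeight h hε.1 hε.2 i p
  have h5 := tendsto_nhds_unique (h3.congr' h4) tendsto_const_nhds
  rw [map_sub, ← smul_eq_C_mul, map_smul, smul_eq_mul] at h5
  rw [dunklOp_apply, map_add, map_sum]
  simp only [map_smul, smul_eq_mul]
  linarith

/-- The adjoint of `T_i` with respect to the Gaussian measure is `2 x_i - T_i`. -/
theorem gaussInt_dunklOp_mul (h : IsPositiveRoots P k) (i : Fin N) (p q : MvPolynomial (Fin N) ℝ) :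
    gaussInt P k (dunklOp P k i p * q) + gaussInt P k (p * dunklOp P k i q) =
      2 * gaussInt P k (X i * (p * q)) := by
  rw [← gaussInt_dunklOp h, ← map_add]
  -- The defect in the Leibniz rule is odd under `σ_η`, so that its integral vanishes.
  have hleib : ∀ η ∈ P, divDiff η (p * q) = divDiff η p * q + p * divDiff η q -
      linForm η * (divDiff η p * divDiff η q) := fun η hη => by
    refine divDiff_eq_of_mul_eq (h.ne_zero hη) ?_
    have h1 : reflPoly η p = p - linForm η * divDiff η p := by
      rw [linForm_mul_divDiff, sub_sub_cancel]
    have h2 : reflPoly η q = q - linForm η * divDiff η q := by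
      rw [linForm_mul_divDiff, sub_sub_cancel]
    rw [map_mul, h1, h2]
    ring
  have hodd : ∀ η ∈ P, gaussInt P k (linForm η * (divDiff η p * divDiff η q)) = 0 :=
    fun η hη => by
    have hη2 := h.inner_self η hη
    have h1 := gaussInt_reflPoly h hη (linForm η * (divDiff η p * divDiff η q))
    have h2 : reflPoly η (linForm η) = -linForm η := by
      rw [← linForm_refl hη2, ← linForm_neg, refl_apply hη2, hη2]
      congr 1
      module
    rw [map_mul (reflPoly η), map_mul (reflPoly η), h2, reflPoly_divDiff_self hη2,
      reflPoly_divDiff_self hη2, neg_mul, map_neg] at h1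
    linarith
  have hsum : dunklOp P k i p * q + p * dunklOp P k i q = dunklOp P k i (p * q) +
      ∑ η ∈ P, ((k η : ℝ) * η i) • (linForm η * (divDiff η p * divDiff η q)) := by
    have h1 : ∑ η ∈ P, ((k η : ℝ) * η i) • divDiff η (p * q) =
        (∑ η ∈ P, ((k η : ℝ) * η i) • divDiff η p) * q +
        p * (∑ η ∈ P, ((k η : ℝ) * η i) • divDiff η q) -
        ∑ η ∈ P, ((k η : ℝ) * η i) • (linForm η * (divDiff η p * divDiff η q)) := by
      rw [Finset.sum_mul, Finset.mul_sum, ← Finset.sum_add_distrib, ← Finset.sum_sub_distrib]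
      refine Finset.sum_congr rfl fun η hη => ?_
      rw [hleib η hη, smul_sub, smul_add, smul_mul_assoc, mul_smul_comm]
    rw [dunklOp_apply, dunklOp_apply, dunklOp_apply, pderiv_mul, h1]
    ring
  rw [hsum, map_add, map_sum]
  have : ∑ η ∈ P, gaussInt P k (((k η : ℝ) * η i) •
      (linForm η * (divDiff η p * divDiff η q))) = 0 :=
    Finset.sum_eq_zero fun η hη => by rw [map_smul, hodd η hη, smul_zero]
  rw [this, add_zero]

/-- The weight is continuous and positive at a vector that defines the positive subsystem. -/
theorem gaussInt_one_pos (h : IsPositiveRoots P k) : 0 < gaussInt P k 1 := by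
  obtain ⟨v, hv⟩ := h.exists_pos
  rw [gaussInt_apply]
  have hint : Integrable fun x : Space N =>
      eval (fun i => x i) 1 * (Real.exp (-‖x‖ ^ 2) * regWeight P k 0 x) :=
    integrable_regWeight le_rfl zero_le_one (hasPolyGrowth_eval 1)
      (continuous_eval_space 1).aestronglyMeasurable
  have hnn : ∀ x : Space N,
      0 ≤ eval (fun i => x i) 1 * (Real.exp (-‖x‖ ^ 2) * regWeight P k 0 x) := fun x => by
    have := regWeight_nonneg (P := P) (k := k) le_rfl x
    rw [map_one]
    positivity
  rw [integral_pos_iff_support_of_nonneg hnn hint]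
  refine IsOpen.measure_pos volume (Continuous.isOpen_support ?_) ⟨v, ?_⟩
  · have h1 := continuous_regWeight (P := P) (k := k) 0
    have h2 := continuous_eval_space (1 : MvPolynomial (Fin N) ℝ)
    fun_prop
  · rw [Function.mem_support, map_one, one_mul]
    refine mul_ne_zero (Real.exp_ne_zero _) (Finset.prod_ne_zero_iff.2 fun η hη => ?_)
    have := hv η hη
    positivity

theorem mehta_eq : mehta P k = (gaussInt P k 1)⁻¹ := by
  simp [mehta, gaussInt_apply, regWeight_zero]

/-- The identity `[p, q]_k = 2^d c_k ∫ (e^{-Δ_k/4} p) (e^{-Δ_k/4} q) e^{-|x|²} ω_k dx` for `p`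
homogeneous of degree `d`. -/
theorem gaussInt_expLaplacian_mul (h : IsPositiveRoots P k) {p : MvPolynomial (Fin N) ℝ} {d : ℕ}
    (hp : p.IsHomogeneous d) (q : MvPolynomial (Fin N) ℝ) :
    mehta P k * gaussInt P k (expLaplacian P k p * expLaplacian P k q) =
      (1 / 2) ^ d * pairing P k p q := by
  let B : MvPolynomial (Fin N) ℝ →ₗ[ℝ] MvPolynomial (Fin N) ℝ →ₗ[ℝ] ℝ :=
    ((LinearMap.mul ℝ (MvPolynomial (Fin N) ℝ)).compl₁₂ (expLaplacianLin h)
      (expLaplacianLin h)).compr₂ (mehta P k • gaussInt P k)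
  have hBdef : ∀ p q, B p q =
      mehta P k * gaussInt P k (expLaplacian P k p * expLaplacian P k q) := fun p q => rfl
  have hB : ∀ i p q, B (X i * p) q = 1 / 2 * B p (dunklOp P k i q) := fun i p q => by
    have h1 := gaussInt_dunklOp_mul h i (expLaplacian P k p) (expLaplacian P k q)
    rw [hBdef, hBdef, expLaplacian_X_mul h, expLaplacian_dunklOp h, sub_mul, map_sub,
      smul_mul_assoc, map_smul, smul_eq_mul, mul_assoc (X i)]
    linear_combination (-mehta P k / 2) * h1
  -- By symmetry, `B 1 (x_i p) = B p (T_i 1) / 2 = 0`.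
  have hsymm : ∀ p q, B p q = B q p := fun p q => by
    rw [hBdef, hBdef, mul_comm (expLaplacian P k p)]
  have hB1 : ∀ q, B 1 q = eval 0 q := fun q => by
    induction q using MvPolynomial.induction_on with
    | C a =>
      rw [hBdef, ← C_1, expLaplacian_C, expLaplacian_C, C_1, one_mul, eval_C, ← mul_one (C a),
        ← smul_eq_C_mul, map_smul, smul_eq_mul, mehta_eq, mul_left_comm,
        inv_mul_cancel₀ (gaussInt_one_pos h).ne', mul_one]
    | add p q hp hq => rw [map_add, map_add, hp, hq]
    | mul_X p i _ =>
      rw [mul_comm, hsymm, hB, ← C_1, dunklOp_C h]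
      simp
  rw [← hBdef]
  exact pairing_eq_of_adjoint B hB hB1 hp q

/-! ### Polynomials times a Gaussian are dense -/

open scoped FourierTransform SchwartzMap ContDiff in
/-- An integrable function with vanishing Fourier transform vanishes almost everywhere: the
Fourier transform is self-adjoint and surjective on Schwartz functions. -/
theorem ae_eq_zero_of_fourier_eq_zero {V : Type*} [NormedAddCommGroup V] [InnerProductSpace ℝ V]
    [FiniteDimensional ℝ V] [MeasurableSpace V] [BorelSpace V] {g : V → ℂ} (hg : Integrable g)
    (h : ∀ ξ, 𝓕 g ξ = 0) : ∀ᵐ x, g x = 0 := by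
  refine ae_eq_zero_of_integral_contDiff_smul_eq_zero hg.locallyIntegrable fun ψ hψ hψc => ?_
  have h1 : HasCompactSupport (Complex.ofRealCLM ∘ ψ) := hψc.comp_left rfl
  have h2 : ContDiff ℝ ∞ (Complex.ofRealCLM ∘ ψ) := by fun_prop
  let Ψ : 𝓢(V, ℂ) := h1.toSchwartzMap h2
  let θ : 𝓢(V, ℂ) := 𝓕⁻ Ψ
  have hθ : 𝓕 (θ : V → ℂ) = Ψ := by
    rw [← SchwartzMap.fourier_coe, FourierTransform.fourier_fourierInv_eq]
  have h3 : ∫ ξ, (𝓕 (θ : V → ℂ) ξ) • g ξ = ∫ x, θ x • 𝓕 g x := by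
    simpa using! VectorFourier.integral_fourierIntegral_smul_eq_flip (L := innerₗ V)
      Real.continuous_fourierChar continuous_inner θ.integrable hg
  rw [hθ] at h3
  simp only [h, smul_zero, integral_zero] at h3
  exact h3

theorem integrable_weightMeasure_iff {E : Type*} [NormedAddCommGroup E] [NormedSpace ℝ E]
    {g : Space N → E} :
    Integrable g (weightMeasure P k) ↔ Integrable fun x => weight P k x • g x := by
  rw [weightMeasure, integrable_withDensity_iff_integrable_smul'
    (measurable_weight P k).ennreal_ofReal (by simp)]
  simp only [ENNReal.toReal_ofReal (weight_nonneg P k _)]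

theorem integral_weightMeasure {E : Type*} [NormedAddCommGroup E] [NormedSpace ℝ E]
    (g : Space N → E) :
    ∫ x, g x ∂weightMeasure P k = ∫ x, weight P k x • g x := by
  rw [weightMeasure, integral_withDensity_eq_integral_toReal_smul
    (measurable_weight P k).ennreal_ofReal (by simp)]
  simp only [ENNReal.toReal_ofReal (weight_nonneg P k _)]

/-- The Gaussian `e^{-|x|²/2}` absorbs exponential growth; this is what makes the exponential series
below integrable term by term. -/
theorem memLp_exp_growth {Φ : Space N → ℂ} (hc : Continuous Φ) {C a : ℝ}
    (hΦ : ∀ x, ‖Φ x‖ ≤ C * Real.exp (a * ‖x‖)) :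
    MemLp (fun x => Φ x * (Real.exp (-‖x‖ ^ 2 / 2) : ℂ)) 2 (weightMeasure P k) := by
  have hcont : Continuous fun x => Φ x * (Real.exp (-‖x‖ ^ 2 / 2) : ℂ) := by fun_prop
  refine (memLp_two_iff_integrable_sq_norm hcont.aestronglyMeasurable).2 ?_
  rw [integrable_weightMeasure_iff]
  have hint := (integrable_mul_exp_mul_gaussian (weight_bound P k |>.imp fun C h => h.imp
    fun n h => ⟨h.1, fun x => (abs_of_nonneg (weight_nonneg P k x)).trans_le (h.2 x)⟩)
    (measurable_weight P k).aestronglyMeasurable (2 * a)).const_mul (C ^ 2)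
  refine hint.mono' ((measurable_weight P k).aestronglyMeasurable.smul
    (hcont.norm.pow 2).aestronglyMeasurable) (Eventually.of_forall fun x => ?_)
  have hw := weight_nonneg P k x
  have hsq : ‖Φ x‖ ^ 2 ≤ (C * Real.exp (a * ‖x‖)) ^ 2 :=
    pow_le_pow_left₀ (norm_nonneg _) (hΦ x) 2
  have h1 : Real.exp (a * ‖x‖) ^ 2 = Real.exp (2 * a * ‖x‖) := by
    rw [← Real.exp_nat_mul]
    congr 1
    push_cast
    ring
  have h2 : Real.exp (-‖x‖ ^ 2 / 2) ^ 2 = Real.exp (-‖x‖ ^ 2) := by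
    rw [← Real.exp_nat_mul]
    congr 1
    push_cast
    ring
  rw [norm_smul, Real.norm_of_nonneg hw, norm_pow, norm_norm, norm_mul, Complex.norm_real,
    Real.norm_of_nonneg (Real.exp_pos _).le, mul_pow, h2]
  calc weight P k x * (‖Φ x‖ ^ 2 * Real.exp (-‖x‖ ^ 2))
      ≤ weight P k x * ((C * Real.exp (a * ‖x‖)) ^ 2 * Real.exp (-‖x‖ ^ 2)) := by gcongr
    _ = _ := by
      rw [mul_pow, h1]
      ring

theorem integrable_exp_growth_mul (f : L2 P k) {Φ : Space N → ℂ} (hc : Continuous Φ) {C a : ℝ}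
    (hΦ : ∀ x, ‖Φ x‖ ≤ C * Real.exp (a * ‖x‖)) :
    Integrable (fun x => Φ x * (Real.exp (-‖x‖ ^ 2 / 2) : ℂ) * f x) (weightMeasure P k) :=
  (memLp_exp_growth hc hΦ).integrable_mul (Lp.memLp f)

theorem exists_exp_growth_eval (p : MvPolynomial (Fin N) ℝ) : ∃ C : ℝ, ∀ x : Space N,
    ‖((eval (fun i => x i) p : ℝ) : ℂ)‖ ≤ C * Real.exp (1 * ‖x‖) := by
  obtain ⟨C, n, hC, h⟩ := eval_bound p
  refine ⟨C * (n.factorial * Real.exp 1), fun x => ?_⟩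
  have h1 : (1 + ‖x‖) ^ n ≤ n.factorial * Real.exp (1 + ‖x‖) := by
    have := Real.pow_div_factorial_le_exp (1 + ‖x‖) (by positivity) n
    rwa [div_le_iff₀ (by positivity), mul_comm] at this
  rw [Complex.norm_real, Real.norm_eq_abs]
  calc _ ≤ C * (1 + ‖x‖) ^ n := h x
    _ ≤ C * (n.factorial * Real.exp (1 + ‖x‖)) := by gcongr
    _ = _ := by
      rw [Real.exp_add, one_mul]
      ring

theorem integrable_eval_mul (f : L2 P k) (p : MvPolynomial (Fin N) ℝ) :
    Integrable (fun x => ((eval (fun i => x i) p : ℝ) : ℂ) * (Real.exp (-‖x‖ ^ 2 / 2) : ℂ) * f x)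
      (weightMeasure P k) := by
  obtain ⟨C, hC⟩ := exists_exp_growth_eval p
  exact integrable_exp_growth_mul f
    (Complex.continuous_ofReal.comp (continuous_eval_space p)) hC

open scoped FourierTransform in
/-- A function in `L²(ω_k dx)` that is orthogonal to all products of a polynomial and the Gaussian
vanishes: the Fourier transform of `f e^{-|x|²/2} ω_k` is a power series in the moments. -/
theorem eq_zero_of_moments_eq_zero (f : L2 P k)
    (hf : ∀ p : MvPolynomial (Fin N) ℝ, ∫ x, ((eval (fun i => x i) p : ℝ) : ℂ) *
      (Real.exp (-‖x‖ ^ 2 / 2) : ℂ) * f x ∂weightMeasure P k = 0) : f = 0 := by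
  have hg : Integrable fun x : Space N =>
      weight P k x • ((Real.exp (-‖x‖ ^ 2 / 2) : ℂ) * f x) := by
    have := integrable_weightMeasure_iff.1 (integrable_eval_mul f 1)
    simpa using this
  have hexp : ∀ ξ : Space N, ∫ x, Complex.exp ((-2 * Real.pi * Complex.I) *
      (inner ℝ ξ x : ℝ)) * (Real.exp (-‖x‖ ^ 2 / 2) : ℂ) * f x ∂weightMeasure P k = 0 := by
    intro ξ
    set c : ℂ := -2 * Real.pi * Complex.I with hc
    -- Partial sums of the exponential series; they are polynomials in `x`.
    let S : ℕ → Space N → ℂ := fun n x =>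
      ∑ m ∈ Finset.range n, (c * (inner ℝ ξ x : ℝ)) ^ m / (m.factorial : ℂ)
    have hS0 : ∀ n, ∫ x, S n x * (Real.exp (-‖x‖ ^ 2 / 2) : ℂ) * f x ∂weightMeasure P k = 0 := by
      intro n
      have h1 : ∀ x, S n x * (Real.exp (-‖x‖ ^ 2 / 2) : ℂ) * f x = ∑ m ∈ Finset.range n,
          (c ^ m / (m.factorial : ℂ)) * (((eval (fun i => x i) (linForm ξ ^ m) : ℝ) : ℂ) *
            (Real.exp (-‖x‖ ^ 2 / 2) : ℂ) * f x) := fun x => by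
        rw [Finset.sum_mul, Finset.sum_mul]
        refine Finset.sum_congr rfl fun m _ => ?_
        rw [map_pow, eval_linForm, mul_pow, Complex.ofReal_pow]
        ring
      simp only [h1]
      rw [integral_finsetSum _ fun m _ => (integrable_eval_mul f _).const_mul _]
      refine Finset.sum_eq_zero fun m _ => ?_
      rw [integral_const_mul, hf, mul_zero]
    have hz : ∀ x : Space N, ‖c * ((inner ℝ ξ x : ℝ) : ℂ)‖ ≤ ‖c‖ * ‖ξ‖ * ‖x‖ := fun x => by
      rw [norm_mul, Complex.norm_real, mul_assoc]
      gcongr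
      exact norm_inner_le_norm ξ x
    have hSb : ∀ n x, ‖S n x‖ ≤ 1 * Real.exp (‖c‖ * ‖ξ‖ * ‖x‖) := fun n x => by
      calc ‖S n x‖ ≤ ∑ m ∈ Finset.range n, ‖c * ((inner ℝ ξ x : ℝ) : ℂ)‖ ^ m / m.factorial := by
            refine (norm_sum_le _ _).trans (Finset.sum_le_sum fun m _ => ?_)
            rw [norm_div, norm_pow, Complex.norm_natCast]
        _ ≤ Real.exp ‖c * ((inner ℝ ξ x : ℝ) : ℂ)‖ :=
            Real.sum_le_exp_of_nonneg (norm_nonneg _) n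
        _ ≤ _ := by
            rw [one_mul]
            exact Real.exp_le_exp.2 (hz x)
    have hSc : ∀ n, Continuous (S n) := fun n => by fun_prop
    have hbound := (integrable_exp_growth_mul f (Φ := fun x =>
      (Real.exp (‖c‖ * ‖ξ‖ * ‖x‖) : ℂ)) (by fun_prop) (C := 1) (a := ‖c‖ * ‖ξ‖) fun x => by
        rw [Complex.norm_real, Real.norm_of_nonneg (Real.exp_pos _).le, one_mul]).norm
    have hlim := tendsto_integral_of_dominated_convergence
      (F := fun n x => S n x * (Real.exp (-‖x‖ ^ 2 / 2) : ℂ) * f x)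
      (f := fun x => Complex.exp (c * (inner ℝ ξ x : ℝ)) * (Real.exp (-‖x‖ ^ 2 / 2) : ℂ) * f x)
      _ (fun n => (integrable_exp_growth_mul f (hSc n) (hSb n)).aestronglyMeasurable) hbound
      (fun n => Eventually.of_forall fun x => by
        rw [norm_mul, norm_mul, norm_mul, norm_mul]
        have := hSb n x
        rw [one_mul] at this
        gcongr
        rwa [Complex.norm_real, Real.norm_of_nonneg (Real.exp_pos _).le])
      (Eventually.of_forall fun x => by
        refine Tendsto.mul_const _ (Tendsto.mul_const _ ?_)
        have := NormedSpace.expSeries_div_hasSum_exp (c * ((inner ℝ ξ x : ℝ) : ℂ))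
        rw [← Complex.exp_eq_exp_ℂ] at this
        exact this.tendsto_sum_nat)
    simp only [hS0] at hlim
    exact tendsto_nhds_unique hlim tendsto_const_nhds
  have hzero := ae_eq_zero_of_fourier_eq_zero hg fun ξ => by
    rw [← hexp ξ, integral_weightMeasure, Real.fourier_eq']
    refine integral_congr_ae (Eventually.of_forall fun x => ?_)
    simp only [smul_eq_mul, Complex.real_smul]
    have : Complex.exp (((-2 * Real.pi * inner ℝ x ξ : ℝ) : ℂ) * Complex.I) =
        Complex.exp ((-2 * Real.pi * Complex.I) * (inner ℝ ξ x : ℝ)) := by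
      rw [real_inner_comm]
      congr 1
      push_cast
      ring
    rw [this]
    ring
  rw [Lp.eq_zero_iff_ae_eq_zero]
  refine (ae_withDensity_iff (measurable_weight P k).ennreal_ofReal).2 ?_
  filter_upwards [hzero] with x hx hw
  have hw' : weight P k x ≠ 0 := fun h0 => hw (by rw [h0, ENNReal.ofReal_zero])
  simpa [hw', Complex.exp_ne_zero] using hx

/-! ### The generalized Hermite functions form a Hilbert basis -/

variable {φ : (Fin N →₀ ℕ) → MvPolynomial (Fin N) ℝ}

/-- The two powers of `2` in the definition combine to `2^{|ν|/2}`. -/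
theorem hermiteFun_eq (ν : Fin N →₀ ℕ) (x : Space N) :
    hermiteFun P k φ ν x = √(mehta P k) * (2 : ℝ) ^ ((ν.degree : ℝ) / 2) *
      (eval (fun i => x i) (expLaplacian P k (φ ν)) * Real.exp (-‖x‖ ^ 2 / 2)) := by
  have h2 : (2 : ℝ) ^ ν.degree =
      (2 : ℝ) ^ ((ν.degree : ℝ) / 2) * (2 : ℝ) ^ ((ν.degree : ℝ) / 2) := by
    rw [← Real.rpow_add two_pos, add_halves, Real.rpow_natCast]
  have h0 : (2 : ℝ) ^ ((ν.degree : ℝ) / 2) ≠ 0 := by positivity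
  rw [hermiteFun, hermitePoly, smul_eval, h2]
  field_simp

theorem inner_hermiteL2_left (ν : Fin N →₀ ℕ) (f : L2 P k) :
    inner ℂ (hermiteL2 P k φ ν) f =
      ∫ x, (hermiteFun P k φ ν x : ℂ) * f x ∂weightMeasure P k := by
  rw [L2.inner_def]
  refine integral_congr_ae ?_
  filter_upwards [(memLp_hermiteFun P k φ ν).coeFn_toLp] with x hx
  rw [hermiteL2, hx]
  simp [mul_comm]

theorem orthonormal_hermiteL2 (h : IsPositiveRoots P k) (hφ : IsOrthonormalPolynomialBasis P k φ) :
    Orthonormal ℂ (hermiteL2 P k φ) := by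
  classical
  rw [orthonormal_iff_ite]
  intro ν μ
  have h1 : inner ℂ (hermiteL2 P k φ ν) (hermiteL2 P k φ μ) = ((√(mehta P k) * √(mehta P k) *
      ((2 : ℝ) ^ ((ν.degree : ℝ) / 2) * (2 : ℝ) ^ ((μ.degree : ℝ) / 2)) *
      gaussInt P k (expLaplacian P k (φ ν) * expLaplacian P k (φ μ)) : ℝ) : ℂ) := by
    rw [inner_hermiteL2_left, gaussInt_apply, ← integral_const_mul, ← integral_complex_ofReal,
      ← integral_congr_ae (f := fun x => ((hermiteFun P k φ ν x * hermiteFun P k φ μ x : ℝ) : ℂ))]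
    · rw [integral_weightMeasure]
      refine integral_congr_ae (Eventually.of_forall fun x => ?_)
      simp only [Complex.real_smul, ← Complex.ofReal_mul, regWeight_zero]
      congr 1
      have hE : Real.exp (-‖x‖ ^ 2) = Real.exp (-‖x‖ ^ 2 / 2) * Real.exp (-‖x‖ ^ 2 / 2) := by
        rw [← Real.exp_add, add_halves]
      rw [hermiteFun_eq, hermiteFun_eq, map_mul, hE]
      ring
    · filter_upwards [(memLp_hermiteFun P k φ μ).coeFn_toLp] with x hx
      rw [hermiteL2, hx, Complex.ofReal_mul]
  have hm : 0 ≤ mehta P k := by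
    rw [mehta_eq]
    exact (inv_pos.2 (gaussInt_one_pos h)).le
  have h2 := gaussInt_expLaplacian_mul h (hφ.homogeneous ν) (φ μ)
  rw [hφ.orthonormal] at h2
  rw [h1, Real.mul_self_sqrt hm, mul_right_comm, h2]
  split_ifs with hνμ
  · subst hνμ
    rw [← Real.rpow_add two_pos, add_halves, Real.rpow_natCast, mul_one, ← mul_pow]
    norm_num
  · simp

theorem span_hermiteL2_orthogonal (h : IsPositiveRoots P k)
    (hφ : IsOrthonormalPolynomialBasis P k φ) :
    (Submodule.span ℂ (Set.range (hermiteL2 P k φ)))ᗮ = ⊥ := by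
  rw [Submodule.eq_bot_iff]
  intro f hf
  let Λ : MvPolynomial (Fin N) ℝ →ₗ[ℝ] ℂ :=
    { toFun := fun p => ∫ x, ((eval (fun i => x i) p : ℝ) : ℂ) *
        (Real.exp (-‖x‖ ^ 2 / 2) : ℂ) * f x ∂weightMeasure P k
      map_add' := fun p q => by
        rw [← integral_add (integrable_eval_mul f p) (integrable_eval_mul f q)]
        refine integral_congr_ae (Eventually.of_forall fun x => ?_)
        simp only [map_add, Complex.ofReal_add]
        ring
      map_smul' := fun c p => by
        rw [RingHom.id_apply, Complex.real_smul, ← integral_const_mul]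
        refine integral_congr_ae (Eventually.of_forall fun x => ?_)
        simp only [smul_eval, Complex.ofReal_mul]
        ring }
  have hm : 0 < mehta P k := by
    rw [mehta_eq]
    exact inv_pos.2 (gaussInt_one_pos h)
  have h1 : Λ ∘ₗ expLaplacianLin h = 0 := by
    refine LinearMap.ext_on_range hφ.span_eq_top fun ν => ?_
    have h2 : inner ℂ (hermiteL2 P k φ ν) f = 0 :=
      hf _ (Submodule.subset_span ⟨ν, rfl⟩)
    have h3 : ((√(mehta P k) * (2 : ℝ) ^ ((ν.degree : ℝ) / 2) : ℝ) : ℂ) *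
        Λ (expLaplacian P k (φ ν)) = 0 := by
      rw [← h2, inner_hermiteL2_left]
      change _ * (∫ x, _ ∂_) = _
      rw [← integral_const_mul]
      refine integral_congr_ae (Eventually.of_forall fun x => ?_)
      simp only [hermiteFun_eq, Complex.ofReal_mul]
      ring
    have h4 : (√(mehta P k) * (2 : ℝ) ^ ((ν.degree : ℝ) / 2) : ℝ) ≠ 0 :=
      mul_ne_zero (Real.sqrt_pos.2 hm).ne' (by positivity)
    exact (mul_eq_zero.1 h3).resolve_left (Complex.ofReal_ne_zero.2 h4)
  refine eq_zero_of_moments_eq_zero f fun p => ?_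
  obtain ⟨q, rfl⟩ := expLaplacian_surjective h p
  exact LinearMap.congr_fun h1 q

/-- The Hilbert basis of generalized Hermite functions. -/
noncomputable def hermiteBasis (h : IsPositiveRoots P k)
    (hφ : IsOrthonormalPolynomialBasis P k φ) : HilbertBasis (Fin N →₀ ℕ) ℂ (L2 P k) :=
  HilbertBasis.mkOfOrthogonalEqBot (orthonormal_hermiteL2 h hφ) (span_hermiteL2_orthogonal h hφ)

theorem repr_fracDunkl (h : IsPositiveRoots P k) (hφ : IsOrthonormalPolynomialBasis P k φ)
    (s : ℝ) (f : L2 P k) (ν : Fin N →₀ ℕ) :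
    (hermiteBasis h hφ).repr (fracDunkl P k φ s f) ν =
      Complex.exp (Complex.I * (ν.degree : ℂ) * (s : ℂ)) * (hermiteBasis h hφ).repr f ν := by
  have hb : ⇑(hermiteBasis h hφ) = hermiteL2 P k φ :=
    HilbertBasis.coe_mkOfOrthogonalEqBot _ _
  have := Unbounded.repr_tsum_exp (hermiteBasis h hφ) (fun ν => ν.degree) s f ν
  rw [hb] at this
  exact this

end Dunkl

theorem mainTheorem9 (N : ℕ) (R P : Finset (Dunkl.Space N)) (k : Dunkl.Space N → ℝ≥0)
    (hR : Dunkl.IsRootSystem R) (hP : Dunkl.IsPositiveSubsystem R P)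
    (hk : Dunkl.IsMultiplicity R k)
    (φ : (Fin N →₀ ℕ) → MvPolynomial (Fin N) ℝ)
    (hφ : Dunkl.IsOrthonormalPolynomialBasis P k φ) :
    ∃ T : Dunkl.L2 P k →ₗ.[ℂ] Dunkl.L2 P k,
      Unbounded.IsGenerator (Dunkl.fracDunkl P k φ) T ∧
      (T.IsClosed ∧ Dense (T.domain : Set (Dunkl.L2 P k))) ∧
      IsSelfAdjoint (Complex.I • T) ∧
      Unbounded.spectrum T = Unbounded.pointSpectrum T ∧
      Unbounded.spectrum T ⊆ Set.range (fun n : ℤ => Complex.I * (n : ℂ)) ∧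
      ∀ z : ℂ, z ∉ Set.range (fun n : ℤ => Complex.I * (n : ℂ)) →
        z ∈ Unbounded.resolventSet T ∧
        ∀ f : Dunkl.L2 P k,
          IntervalIntegrable (fun s : ℝ => Complex.exp (-z * s) • Dunkl.fracDunkl P k φ s f)
            volume 0 (2 * Real.pi) ∧
          Unbounded.resolvent T z f = (1 - Complex.exp (-2 * Real.pi * z))⁻¹ •
            ∫ s in (0 : ℝ)..(2 * Real.pi),
              Complex.exp (-z * s) • Dunkl.fracDunkl P k φ s f := by
  have h := Dunkl.IsPositiveSubsystem.isPositiveRoots hR hP hk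
  have hU := Dunkl.repr_fracDunkl h hφ
  have hσ := Unbounded.spectrum_diagOp (Dunkl.hermiteBasis h hφ) _
    (Unbounded.isClosed_range_I_mul_nat fun ν => ν.degree)
  have hsub : Unbounded.spectrum (Unbounded.diagOp (Dunkl.hermiteBasis h hφ)
      fun ν => Complex.I * (ν.degree : ℂ)) ⊆ Set.range fun n : ℤ => Complex.I * (n : ℂ) := by
    rw [hσ.1]
    rintro _ ⟨ν, rfl⟩
    exact ⟨ν.degree, by simp⟩
  refine ⟨Unbounded.diagOp (Dunkl.hermiteBasis h hφ) fun ν => Complex.I * (ν.degree : ℂ),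
    Unbounded.isGenerator_diagOp hU,
    ⟨Unbounded.isClosed_diagOp _ _, Unbounded.dense_diagOp_domain _ _⟩, ?_,
    hσ.1.trans hσ.2.symm, hsub, fun z hz => ⟨?_, Unbounded.resolvent_diagOp hU hz⟩⟩
  · rw [Unbounded.smul_diagOp _ _ Complex.I_ne_zero]
    refine Unbounded.isSelfAdjoint_diagOp _ _ fun ν => ?_
    rw [← mul_assoc, Complex.I_mul_I]
    simp
  · by_contra hn
    exact hz (hsub hn)
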